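/- Throughout, $\log(x):=\max(\ln x,1)$. Let $U(k,\alpha)=C\sqrt{\tfrac1k\log(\log(k)/\alpha)}$, where $C$ is any fixed constant for which $U$ is an anytime confidence radius: for every 1-sub-Gaussian distribution (one with $\mathbb E[e^{s(X-\mathbb E X)}]\le e^{s^2/2}$ for all $s\in\mathbb R$) and every $\alpha\in(0,1)$, with probability at least $1-\alpha$ the empirical means of i.i.d. samples are within $U(k,\alpha)$ of the mean for all $k\ge1$ simultaneously. Such constants exist. Consider $n$ arms with 1-sub-Gaussian reward distributions and means $1\ge\mu_1\ge\dots\ge\mu_n\ge0$; let $0<\delta\le 0.025$ and $\epsilon>0$. Algorithm. Put $\ell=0$, $R_0=0$. In round $t=1,2,\dots$: (i) if $t\ge 2^{\ell}\ell$, draw a new bracket $A_{\ell+1}$ uniformly at random (independently of everything else) among the subsets of $[n]$ of size $\min(n,2^{\ell+1})$ and increase $\ell$ by one; (ii) set $R_t=1+R_{t-1}\mathbf 1\{R_{t-1}<\ell\}$; (iii) pull an arm $I_t\in A_{R_t}$ not pulled before in bracket $R_t$ if there is one, and otherwise an arm $I_t\in A_{R_t}$ maximising $\widehat\mu_{i,R_t,T}+U(T,\delta)$,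 where $T=T_{i,R_t}$ is the number of previous pulls of $i$ in bracket $R_t$; (iv) recommend an arm $O_t$ maximising $\widehat\mu_{i,r,T_{i,r}(t)}-U\big(T_{i,r}(t),\tfrac{\delta}{|A_r|r^2}\big)$ over all open brackets $r\le\ell$ and all $i\in A_r$, where $T_{i,r}(t)$ is the number of pulls of $i$ in bracket $r$ in rounds $1,\dots,t$ and arms with $T_{i,r}(t)=0$ are disregarded. Here $\widehat\mu_{i,r,k}$ is the mean of the first $k$ observations of arm $i$ in bracket $r$; observations are not shared between brackets, and ties are broken arbitrarily. Let $\mathcal F_t$ be generated by the pulled arms, observed rewards and recommendations of rounds $1,\dots,t$. Let $m=|\{i:\mu_i>\mu_1-\epsilon\}|$ and assume $m<n$. Write $\Delta_{i,k}=\mu_i-\mu_k$ and $\Delta_{i\vee j,k}=\max(\mu_i,\mu_j)-\mu_k$, and for $j\in[m]$ let $$H_{\mathrm{best}}(\epsilon;j)=\frac1j\left(\sum_{i=1}^m\Delta_{i\vee j,m+1}^{-2}\log\Big(\frac{n}{j\delta}\log(\Delta_{i\vee j,m+1}^{-2})\Big)+\sum_{i=m+1}^n\Delta_{j,i}^{-2}\log\Big(\frac{\log(\Delta_{j,i}^{-2})}{\delta}\Big)\right).$$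 Then there is a constant $c$, depending only on $C$, such that for every such instance there is a stopping time $\tau$ with respect to $(\mathcal F_t)$ with $$\mathbb E[\tau]\le c\,\min_{j\in[m]}H_{\mathrm{best}}(\epsilon;j)\,\log\Big(H_{\mathrm{best}}(\epsilon;j)+\Delta_{j,m+1}^{-2}\log\big(\tfrac{n}{j\delta}\log(\Delta_{j,m+1}^{-2})\big)\Big)$$ and $\mathbb P(\exists s\ge\tau:\ \mu_{O_s}\le\mu_1-\epsilon)\le2\delta$. -/

import Mathlib

open MeasureTheory ProbabilityTheory
open scoped ENNReal

noncomputable section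

/-- The truncated logarithm `log x = max (ln x, 1)`. -/
def logOne (x : ℝ) : ℝ := max (Real.log x) 1

/-- The confidence radius `U(k, α) = C √((1/k) log(log k / α))` after `k ≥ 1` samples, with the
truncated logarithm. -/
def confRadius (C : ℝ) (k : ℕ) (α : ℝ) : ℝ :=
  C * Real.sqrt (1 / (k : ℝ) * logOne (logOne (k : ℝ) / α))

/-- A distribution on `ℝ` is `1`-sub-Gaussian: `E[exp (s (x - mean))] ≤ exp (s² / 2)` for all
real `s`. -/
def IsOneSubGaussian (ν : Measure ℝ) : Prop :=
  HasSubgaussianMGF (fun x => x - ∫ y, y ∂ν) 1 ν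

/-- `C` is an admissible constant in the radius `U`: for every `1`-sub-Gaussian distribution and
every level `α ∈ (0,1)`, with probability at least `1 - α` the empirical means of an i.i.d.
sequence stay within `U(k, α)` of the mean simultaneously for all `k ≥ 1`. -/
def IsAnytimeConstant (C : ℝ) : Prop :=
  ∀ (ν : Measure ℝ) [IsProbabilityMeasure ν], IsOneSubGaussian ν →
    ∀ α : ℝ, 0 < α → α < 1 →
      ENNReal.ofReal (1 - α) ≤
        (Measure.infinitePi (fun _ : ℕ => ν))
          {x : ℕ → ℝ | ∀ k : ℕ, 1 ≤ k →
            |(∑ s ∈ Finset.range k, x s) / (k : ℝ) - ∫ y, y ∂ν| ≤ confRadius C k α}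

/-! ### The deterministic schedule. Rounds and brackets are numbered from `1`. -/

/-- `openBrackets t` is the number `ℓ` of brackets that are open during round `t`: at the start of
round `t` one more bracket is opened if `t ≥ 2 ^ ℓ * ℓ`. -/
def openBrackets : ℕ → ℕ
  | 0 => 0
  | t + 1 =>
      if 2 ^ openBrackets t * openBrackets t ≤ t + 1 then openBrackets t + 1 else openBrackets t

/-- `activeBracket t` is the bracket `R_t` used in round `t`:
`R_0 = 0` and `R_t = 1 + R_{t-1} 1{R_{t-1} < ℓ}`. -/
def activeBracket : ℕ → ℕ
  | 0 => 0
  | t + 1 => 1 + if activeBracket t < openBrackets (t + 1) then activeBracket t else 0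

/-- The size `n ∧ 2 ^ r` of the bracket `r`. -/
def bracketSize (n r : ℕ) : ℕ := min n (2 ^ r)

/-! ### Quantities along one realization: `p t` is the arm pulled in round `t`, and `x i r s` is
the outcome of the `(s+1)`-st pull of arm `i` in bracket `r`. -/

/-- The number `T_{i,r}` of pulls of arm `i` in bracket `r` during the rounds `1, …, t`. -/
def pullCount {n : ℕ} (p : ℕ → Fin n) (i : Fin n) (r t : ℕ) : ℕ :=
  ((Finset.Icc 1 t).filter (fun s => activeBracket s = r ∧ p s = i)).card

/-- The mean of the first `k` outcomes of arm `i` in bracket `r`. -/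
def empMean {n : ℕ} (x : Fin n → ℕ → ℕ → ℝ) (i : Fin n) (r k : ℕ) : ℝ :=
  (∑ s ∈ Finset.range k, x i r s) / (k : ℝ)

/-- Upper confidence bound of arm `i` in bracket `r` after `k` pulls, at level `δ`. -/
def ucb {n : ℕ} (C δ : ℝ) (x : Fin n → ℕ → ℕ → ℝ) (i : Fin n) (r k : ℕ) : ℝ :=
  empMean x i r k + confRadius C k δ

/-- Lower confidence bound of arm `i` in bracket `r` after `k` pulls, at level
`δ / (|A_r| r²)`. -/
def lcb {n : ℕ} (C δ : ℝ) (x : Fin n → ℕ → ℕ → ℝ) (i : Fin n) (r k : ℕ) : ℝ :=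
  empMean x i r k - confRadius C k (δ / ((bracketSize n r : ℝ) * (r : ℝ) ^ 2))

/-- The sampling rule in round `t`, with `a` the brackets: pull an arm of the active bracket that
has not been pulled in it before, if there is one, and otherwise an arm of the active bracket with
the largest upper confidence bound. Ties are broken arbitrarily. -/
def IsPullAt {n : ℕ} (C δ : ℝ) (a : ℕ → Finset (Fin n)) (x : Fin n → ℕ → ℕ → ℝ)
    (p : ℕ → Fin n) (t : ℕ) : Prop :=
  p t ∈ a (activeBracket t) ∧
  ((∃ i ∈ a (activeBracket t), pullCount p i (activeBracket t) (t - 1) = 0) →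
    pullCount p (p t) (activeBracket t) (t - 1) = 0) ∧
  ((∀ i ∈ a (activeBracket t), pullCount p i (activeBracket t) (t - 1) ≠ 0) →
    ∀ i ∈ a (activeBracket t),
      ucb C δ x i (activeBracket t) (pullCount p i (activeBracket t) (t - 1)) ≤
        ucb C δ x (p t) (activeBracket t) (pullCount p (p t) (activeBracket t) (t - 1)))

/-- `o` is a legitimate recommendation at the end of round `t`: it has the largest lower confidence
bound, in some open bracket, among all arms in all open brackets. An arm without a sample in a
bracket has lower confidence bound `-∞` there. Ties are broken arbitrarily. -/
def IsRecommendationAt {n : ℕ} (C δ : ℝ) (a : ℕ → Finset (Fin n)) (x : Fin n → ℕ → ℕ → ℝ)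
    (p : ℕ → Fin n) (t : ℕ) (o : Fin n) : Prop :=
  ∃ r : ℕ, 1 ≤ r ∧ r ≤ openBrackets t ∧ o ∈ a r ∧ 1 ≤ pullCount p o r t ∧
    ∀ r' : ℕ, 1 ≤ r' → r' ≤ openBrackets t → ∀ i ∈ a r', 1 ≤ pullCount p i r' t →
      lcb C δ x i r' (pullCount p i r' t) ≤ lcb C δ x o r (pullCount p o r t)

/-! ### Random runs of the algorithm -/

/-- A run of the algorithm with confidence parameter `δ` and radius constant `C` on the arms
`ν 0, …, ν (n-1)`, on a probability space `(Ω, P)`. -/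
structure BracketUCBRun {n : ℕ} (C δ : ℝ) (ν : Fin n → Measure ℝ)
    {Ω : Type*} [MeasurableSpace Ω] (P : Measure Ω) where
  /-- `A r` is the bracket number `r ≥ 1`. -/
  A : ℕ → Ω → Finset (Fin n)
  /-- `X i r s` is the outcome of the `(s+1)`-st pull of arm `i` in bracket `r`. -/
  X : Fin n → ℕ → ℕ → Ω → ℝ
  /-- `I t` is the arm pulled in round `t ≥ 1`. -/
  I : ℕ → Ω → Fin n
  /-- `O t` is the arm recommended at the end of round `t ≥ 1`. -/
  O : ℕ → Ω → Fin n
  measurable_A : ∀ r, Measurable (A r)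
  measurable_X : ∀ i r s, Measurable (X i r s)
  measurable_I : ∀ t, Measurable (I t)
  measurable_O : ∀ t, Measurable (O t)
  /-- Bracket `r` is uniformly distributed on the sets of `n ∧ 2 ^ r` arms. -/
  card_A : ∀ r, 1 ≤ r → ∀ ω, (A r ω).card = bracketSize n r
  uniform_A : ∀ r, 1 ≤ r → ∀ S : Finset (Fin n), S.card = bracketSize n r →
    P {ω | A r ω = S} = ((n.choose (bracketSize n r) : ℕ) : ℝ≥0∞)⁻¹
  /-- Every pull of arm `i` has the distribution `ν i`. -/
  law_X : ∀ i r s, P.map (X i r s) = ν i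
  /-- All brackets and all outcomes are mutually independent. -/
  indep : iIndep
    (Sum.elim (fun r : ℕ => MeasurableSpace.comap (A r) inferInstance)
      (fun q : Fin n × ℕ × ℕ => MeasurableSpace.comap (X q.1 q.2.1 q.2.2) inferInstance)) P
  pull_rule : ∀ t, 1 ≤ t → ∀ ω,
    IsPullAt C δ (fun r => A r ω) (fun i r s => X i r s ω) (fun s => I s ω) t
  recommend_rule : ∀ t, 1 ≤ t → ∀ ω,
    IsRecommendationAt C δ (fun r => A r ω) (fun i r s => X i r s ω) (fun s => I s ω) t (O t ω)

namespace BracketUCBRun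

variable {n : ℕ} {C δ : ℝ} {ν : Fin n → Measure ℝ} {Ω : Type*} [MeasurableSpace Ω] {P : Measure Ω}

/-- The reward observed in round `t`. -/
def obs (run : BracketUCBRun C δ ν P) (t : ℕ) (ω : Ω) : ℝ :=
  run.X (run.I t ω) (activeBracket t)
    (pullCount (fun s => run.I s ω) (run.I t ω) (activeBracket t) (t - 1)) ω

lemma measurable_pullCount (run : BracketUCBRun C δ ν P) (i : Fin n) (r t : ℕ) :
    Measurable (fun ω => pullCount (fun s => run.I s ω) i r t) := by
  simp only [pullCount, Finset.card_filter]
  refine Finset.measurable_sum _ fun s _ => ?_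
  refine Measurable.ite ?_ measurable_const measurable_const
  exact (MeasurableSet.const _).inter (run.measurable_I s (measurableSet_singleton i))

lemma measurable_obs (run : BracketUCBRun C δ ν P) (t : ℕ) : Measurable (run.obs t) := by
  have h1 : Measurable (fun q : (Fin n × ℕ) × Ω => run.X q.1.1 (activeBracket t) q.1.2 q.2) :=
    measurable_from_prod_countable_right fun q => run.measurable_X q.1 (activeBracket t) q.2
  have h3 : Measurable (fun q : Fin n × Ω =>
      pullCount (fun s => run.I s q.2) q.1 (activeBracket t) (t - 1)) :=
    measurable_from_prod_countable_right fun i =>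
      run.measurable_pullCount i (activeBracket t) (t - 1)
  have h2 : Measurable (fun ω =>
      pullCount (fun s => run.I s ω) (run.I t ω) (activeBracket t) (t - 1)) :=
    h3.comp ((run.measurable_I t).prodMk measurable_id)
  exact h1.comp (((run.measurable_I t).prodMk h2).prodMk measurable_id)

/-- The filtration generated by playing the algorithm: `F_t` is generated by the pulled arms, the
observed rewards and the recommendations of the rounds `1, …, t`. -/
def history (run : BracketUCBRun C δ ν P) : Filtration ℕ ‹MeasurableSpace Ω› where
  seq t := ⨆ s ∈ Finset.Icc 1 t,
    MeasurableSpace.comap (fun ω => (run.I s ω, run.obs s ω, run.O s ω)) inferInstance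
  mono' t u htu := biSup_mono fun s hs => by
    rw [Finset.mem_Icc] at hs ⊢
    exact ⟨hs.1, hs.2.trans htu⟩
  le' t := iSup₂_le fun s _ => Measurable.comap_le
    ((run.measurable_I s).prodMk ((run.measurable_obs s).prodMk (run.measurable_O s)))

end BracketUCBRun

/-! ### The complexity of an instance -/

/-- The number `m` of `ε`-good arms when `μ 0` is the largest mean. -/
def numGood {n : ℕ} [NeZero n] (μ : Fin n → ℝ) (ε : ℝ) : ℕ :=
  (Finset.univ.filter (fun i => μ 0 - ε < μ i)).card

/-- `H_best(ε; j)` for means `μ 0 ≥ μ 1 ≥ …`. Arms are numbered from `0` here, so that the argument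
`j` is the arm with number `j + 1` in the usual numbering, and `b` is the first arm that is
not `ε`-good (number `m + 1`); the `ε`-good arms are those before `b`. -/
def Hbest {n : ℕ} (μ : Fin n → ℝ) (δ : ℝ) (b j : Fin n) : ℝ :=
  1 / ((j : ℝ) + 1) *
    (∑ i ∈ Finset.univ.filter (fun i => i < b),
        1 / (max (μ i) (μ j) - μ b) ^ 2 *
          logOne ((n : ℝ) / (((j : ℝ) + 1) * δ) * logOne (1 / (max (μ i) (μ j) - μ b) ^ 2)) +
      ∑ i ∈ Finset.univ.filter (fun i => b ≤ i),
        1 / (μ j - μ i) ^ 2 * logOne (logOne (1 / (μ j - μ i) ^ 2) / δ))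

/-- The expression `H log (H + Δ_{j,m+1}⁻² log (n/(jδ) log Δ_{j,m+1}⁻²))`, with `H = H_best(ε; j)`;
numbering as in `Hbest`. -/
def epsGoodBound {n : ℕ} (μ : Fin n → ℝ) (δ : ℝ) (b j : Fin n) : ℝ :=
  Hbest μ δ b j * logOne (Hbest μ δ b j +
    1 / (μ j - μ b) ^ 2 *
      logOne ((n : ℝ) / (((j : ℝ) + 1) * δ) * logOne (1 / (μ j - μ b) ^ 2)))

end

/-! The stopping time is `certTime`: the first round at whose end some arm has, in some open bracket
`r`, so many samples that its mean minus twice its radius at level `δ / (|A_r| r²)` exceeds the mean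
of `b`, the best arm that is not `ε`-good. The thresholds are deterministic functions of the
instance, so only pull counts have to be observed, and the time does not depend on `j`.

Correctness. If all radii hold at the levels of the lower bounds, a certified arm has lower bound
above `μ b`, and the recommended arm, whose lower bound is at least as large, has mean above `μ b`
from then on (`lt_recommended_of_certified`). Bracket `r` contributes failure probability `δ / r²`,
because membership of an arm in `A_r` is independent of its outcomes (`measure_radiusFails_le`).

Speed. Fix `j`. Call a bracket good if it contains an arm of index at most `j` whose upper bound is
always valid and if the sum of `pullBound` over its arms is at most `N`. While nothing is certified,
every pull after the first of an arm in such a bracket is of an unresolved arm with upper bound at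
least `μ j` (`canBePulled_of_not_certified`). Beyond the sample size at which the radius falls below
an eighth of the gap, this forces a deviation of the empirical mean by a quarter of the gap, which
is exponentially rare (`le_empMean_sub_of_canBePulled`). Since `pullBound` is a function of the
outcomes alone, it is independent of the bracket, and averaging over a random bracket of size of
order `n / (j + 1)` turns the sum of all arm costs into `Hbest`.

Restarts. From the first bracket `r₀` of that size on, each bracket fails to be good with
probability at most `1 / 16` (`measure_goodBracket_compl_le`), independently of the others. A good
bracket `r₀ + s` yields certification within `8 ^ s` times a constant times `H log H` (`le_horizon`,
`horizon_add_one_le`), the logarithm paying for the round robin over the open brackets. Summing `8 ^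
s * 16 ^ (-s)` gives the expectation (`lintegral_certTime_le`).

The existence of an admissible radius constant is a separate matter: a maximal inequality on dyadic
blocks. -/

noncomputable section

/-! ### The truncated logarithm -/

lemma one_le_logOne (x : ℝ) : 1 ≤ logOne x := le_max_right _ _

lemma logOne_pos (x : ℝ) : 0 < logOne x := zero_lt_one.trans_le (one_le_logOne x)

lemma log_le_logOne (x : ℝ) : Real.log x ≤ logOne x := le_max_left _ _

lemma logOne_mono {x y : ℝ} (hx : 0 < x) (h : x ≤ y) : logOne x ≤ logOne y :=
  max_le_max (Real.log_le_log hx h) le_rfl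

lemma logOne_mul_le {x y : ℝ} (hx : 0 < x) (hy : 0 < y) :
    logOne (x * y) ≤ logOne x + logOne y := by
  refine max_le ?_ (by linarith [one_le_logOne x, one_le_logOne y])
  rw [Real.log_mul hx.ne' hy.ne']
  exact add_le_add (log_le_logOne x) (log_le_logOne y)

lemma logOne_mul_le_mul {x y : ℝ} (hx : 0 < x) (hy : 0 < y) :
    logOne (x * y) ≤ 2 * (logOne x * logOne y) := by
  have := logOne_mul_le hx hy
  nlinarith [one_le_logOne x, one_le_logOne y]

lemma logOne_le_self {x : ℝ} (hx : 1 ≤ x) : logOne x ≤ x :=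
  max_le (by linarith [Real.log_le_sub_one_of_pos (show 0 < x by linarith)]) hx

lemma logOne_le_two_mul_sqrt {x : ℝ} (hx : 1 ≤ x) : logOne x ≤ 2 * Real.sqrt x := by
  have h1 : 1 ≤ Real.sqrt x := Real.one_le_sqrt.2 hx
  refine max_le ?_ (by linarith)
  have h2 : Real.log x = 2 * Real.log (Real.sqrt x) := by
    rw [Real.log_sqrt (by linarith)]; ring
  have := Real.log_le_sub_one_of_pos (show 0 < Real.sqrt x by linarith)
  linarith

/-- Inversion of the confidence radius: after order `x log (log x / α)` samples, the squared radius
is below `1 / (64 x)`. -/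
lemma exists_confRadius_lt (C : ℝ) : ∃ K : ℝ, 1 ≤ K ∧ ∀ x α : ℝ, 1 ≤ x → 0 < α → α ≤ 1 →
    ∀ k : ℕ, K * (x * logOne (logOne x / α)) ≤ k →
      ∀ d : ℝ, 0 < d → x = 1 / d ^ 2 → confRadius C k α < d / 8 := by
  -- With `z = k / x`, the logarithm in the radius is at most `L + 4 √z`, and `64 C²` times it must
  -- stay below `z`. The square makes `√z ≥ 1024 C²`, which handles the root, while `z ≥ K L`
  -- handles `L`.
  refine ⟨(1 + 1024 * C ^ 2) ^ 2, by nlinarith [sq_nonneg C], ?_⟩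
  intro x α hx hα hα1 k hk d hd hxd
  set K : ℝ := (1 + 1024 * C ^ 2) ^ 2 with hK
  have hK1 : 1 ≤ K := by rw [hK]; nlinarith [sq_nonneg C]
  set L := logOne (logOne x / α) with hL
  have hL1 : 1 ≤ L := one_le_logOne _
  have hx0 : 0 < x := by linarith
  set z : ℝ := k / x with hz
  have hkz : (k : ℝ) = x * z := by rw [hz]; field_simp
  have hzL : K * L ≤ z := by
    rw [hz, le_div_iff₀ hx0]; nlinarith
  have hz1 : 1 ≤ z := by nlinarith
  have hKz : K ≤ z := by nlinarith
  have hk0 : (0 : ℝ) < k := by rw [hkz]; positivity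
  have h1 : logOne (logOne k / α) ≤ L + 4 * Real.sqrt z := by
    have e1 : logOne (k : ℝ) ≤ 2 * (logOne x * logOne z) := by
      rw [hkz]; exact logOne_mul_le_mul hx0 (by linarith)
    have e2 : logOne (k : ℝ) / α ≤ (logOne x / α) * (2 * logOne z) := by
      rw [div_mul_eq_mul_div]
      gcongr
      linarith
    have p1 := logOne_pos x
    have p2 := logOne_pos z
    have e3 : logOne (logOne (k : ℝ) / α) ≤ L + logOne (2 * logOne z) :=
      (logOne_mono (div_pos (logOne_pos _) hα) e2).trans
        (logOne_mul_le (by positivity) (by positivity))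
    have e4 : logOne (2 * logOne z) ≤ 2 * logOne z :=
      logOne_le_self (by linarith [one_le_logOne z])
    linarith [logOne_le_two_mul_sqrt hz1]
  have hs : 1 + 1024 * C ^ 2 ≤ Real.sqrt z :=
    Real.le_sqrt_of_sq_le (by rw [← hK]; exact hKz)
  have hsz : Real.sqrt z * Real.sqrt z = z := Real.mul_self_sqrt (by linarith)
  have hC : 64 * C ^ 2 * logOne (logOne k / α) < z := by
    have q1 : 64 * C ^ 2 * L ≤ z / 4 := by
      have : 256 * C ^ 2 ≤ K := by rw [hK]; nlinarith [sq_nonneg C, sq_nonneg (C ^ 2)]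
      nlinarith
    have q2 : 64 * C ^ 2 * (4 * Real.sqrt z) ≤ z / 4 := by nlinarith [sq_nonneg C]
    have q3 := mul_le_mul_of_nonneg_left h1 (show 0 ≤ 64 * C ^ 2 by positivity)
    nlinarith
  have hsq : confRadius C k α ≤ |C| * Real.sqrt (1 / (k : ℝ) * logOne (logOne (k : ℝ) / α)) := by
    unfold confRadius
    exact mul_le_mul_of_nonneg_right (le_abs_self C) (Real.sqrt_nonneg _)
  refine hsq.trans_lt ?_
  refine lt_of_pow_lt_pow_left₀ 2 (by positivity) ?_
  have hnn : 0 ≤ 1 / (k : ℝ) * logOne (logOne (k : ℝ) / α) :=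
    mul_nonneg (by positivity) (logOne_pos _).le
  rw [mul_pow, sq_abs, Real.sq_sqrt hnn]
  have hd2 : (d / 8) ^ 2 = 1 / (64 * x) := by rw [hxd]; field_simp; norm_num
  rw [hd2, lt_div_iff₀ (by positivity), hkz]
  have : C ^ 2 * (1 / (x * z) * logOne (logOne (x * z) / α)) * (64 * x)
      = (64 * C ^ 2 * logOne (logOne (x * z) / α)) / z := by field_simp
  rw [this, div_lt_one (by linarith), ← hkz]
  exact hC

lemma confRadius_anti_level {C : ℝ} (hC : 0 ≤ C) (k : ℕ) {α β : ℝ} (hα : 0 < α) (h : α ≤ β) :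
    confRadius C k β ≤ confRadius C k α := by
  unfold confRadius
  gcongr
  exact logOne_mono (div_pos (logOne_pos _) (hα.trans_le h))
    (div_le_div_of_nonneg_left (logOne_pos _).le hα h)

/-! ### The schedule -/

lemma openBrackets_mono : Monotone openBrackets := by
  refine monotone_nat_of_le_succ fun t => ?_
  rw [openBrackets]; split_ifs <;> omega

lemma one_le_openBrackets {t : ℕ} (ht : 1 ≤ t) : 1 ≤ openBrackets t :=
  (show 1 ≤ openBrackets 1 by simp [openBrackets]).trans (openBrackets_mono ht)

/-- At most one bracket opens per round; this invariant shows that one is always enough, so that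
bracket `r` is open from round `2 ^ r * r` on. -/
lemma lt_two_pow_mul_openBrackets {t : ℕ} (ht : 1 ≤ t) :
    t < 2 ^ openBrackets t * openBrackets t := by
  induction t, ht using Nat.le_induction with
  | base => simp [openBrackets]
  | succ t ht ih =>
    rw [openBrackets]
    split_ifs with h
    · rw [pow_succ]
      have : 1 ≤ 2 ^ openBrackets t := Nat.one_le_two_pow
      nlinarith
    · omega

lemma two_pow_openBrackets_le {t : ℕ} (ht : 1 ≤ t) : 2 ^ openBrackets t ≤ 2 * t := by
  induction t, ht using Nat.le_induction with
  | base => simp [openBrackets]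
  | succ t ht ih =>
    rw [openBrackets]
    split_ifs with h
    · rw [pow_succ]
      have : 1 ≤ openBrackets t := one_le_openBrackets ht
      nlinarith [Nat.one_le_two_pow (n := openBrackets t)]
    · omega

lemma le_openBrackets {r t : ℕ} (hr : 1 ≤ r) (ht : 2 ^ r * r ≤ t) : r ≤ openBrackets t := by
  by_contra h
  push Not at h
  have h1 : 1 ≤ t := le_trans (by have := Nat.one_le_two_pow (n := r); nlinarith) ht
  have h2 := lt_two_pow_mul_openBrackets h1
  have h3 : 2 ^ openBrackets t * openBrackets t ≤ 2 ^ r * r :=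
    Nat.mul_le_mul (Nat.pow_le_pow_right (by norm_num) h.le) h.le
  omega

lemma openBrackets_le_logOne {t : ℕ} (ht : 1 ≤ t) : (openBrackets t : ℝ) ≤ 3 * logOne t := by
  have h1 : ((2 : ℝ) ^ openBrackets t) ≤ 2 * t := by exact_mod_cast two_pow_openBrackets_le ht
  have h2 := Real.log_le_log (by positivity) h1
  have ht' : (0 : ℝ) < t := by exact_mod_cast ht
  rw [Real.log_pow, Real.log_mul (by norm_num) ht'.ne'] at h2
  have h3 := Real.log_two_gt_d9
  have h4 := log_le_logOne (t : ℝ)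
  have h5 := one_le_logOne (t : ℝ)
  have h6 := Real.log_two_lt_d9
  nlinarith

lemma activeBracket_le (t : ℕ) : activeBracket t ≤ openBrackets t := by
  cases t with
  | zero => simp [activeBracket]
  | succ t =>
    have := one_le_openBrackets (show 1 ≤ t + 1 by omega)
    rw [activeBracket]
    split_ifs with h <;> omega

/-- The number of rounds among `1, …, t` spent in bracket `r`. -/
def bracketRounds (r t : ℕ) : ℕ := ((Finset.Icc 1 t).filter (fun s => activeBracket s = r)).card

lemma bracketRounds_succ (r t : ℕ) :
    bracketRounds r (t + 1) = bracketRounds r t + if activeBracket (t + 1) = r then 1 else 0 := by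
  unfold bracketRounds
  rw [← Finset.insert_Icc_right_eq_Icc_add_one (by omega), Finset.filter_insert]
  split_ifs with h
  · rw [Finset.card_insert_of_notMem (by simp)]
  · simp

/-- The number of rounds since bracket `r` was last active, in a cycle of length `L`. -/
def cyclePos (L r t : ℕ) : ℕ :=
  if r ≤ activeBracket t then activeBracket t - r else L + activeBracket t - r

/-- Potential argument: the right-hand side grows by at least one each round. Outside bracket `r`
the cycle position advances; on a visit to `r` it drops from at most `L - 1` to `0` while the first
term gains `L`. A fixed `L` bounding all cycle lengths up to `t` absorbs the brackets opened
meanwhile. -/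
lemma sub_le_mul_bracketRounds {L r t₀ t : ℕ} (hr : 1 ≤ r) (hr0 : r ≤ openBrackets t₀)
    (h0 : t₀ ≤ t) (hL : openBrackets t ≤ L) :
    t - t₀ ≤ L * bracketRounds r t + cyclePos L r t := by
  induction t, h0 using Nat.le_induction with
  | base => simp
  | succ t ht ih =>
    have hmono := openBrackets_mono (show t ≤ t + 1 by omega)
    have ih := ih (hmono.trans hL)
    have h1 := openBrackets_mono ht
    have h3 := activeBracket_le t
    have hA : activeBracket (t + 1) =
      1 + if activeBracket t < openBrackets (t + 1) then activeBracket t else 0 := rfl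
    rw [bracketRounds_succ, mul_add]
    unfold cyclePos at ih ⊢
    generalize activeBracket (t + 1) = a' at *
    generalize activeBracket t = a at *
    generalize openBrackets (t + 1) = l' at *
    generalize L * bracketRounds r t = q at *
    split_ifs at * <;> simp only [mul_one, mul_zero] <;> omega

lemma le_add_mul_bracketRounds {r t₀ t : ℕ} (hr : 1 ≤ r) (hr0 : r ≤ openBrackets t₀)
    (h0 : t₀ ≤ t) : t ≤ t₀ + openBrackets t * (bracketRounds r t + 1) := by
  have h1 := sub_le_mul_bracketRounds hr hr0 h0 le_rfl
  have h2 : cyclePos (openBrackets t) r t ≤ openBrackets t := by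
    have := activeBracket_le t
    unfold cyclePos; split_ifs <;> omega
  rw [mul_add]; omega

/-! ### Counting subsets -/

/-- Factor by factor, `(n - j - a) / (n - a) ≤ (n - j) / n`: drawing without replacement misses `j`
given items no more often than drawing with replacement. -/
lemma descFactorial_sub_mul_pow_le (n j s : ℕ) :
    (n - j).descFactorial s * n ^ s ≤ (n - j) ^ s * n.descFactorial s := by
  induction s with
  | zero => simp
  | succ s ih =>
    rw [Nat.descFactorial_succ, Nat.descFactorial_succ, pow_succ, pow_succ]
    have h : (n - j - s) * n ≤ (n - j) * (n - s) := by
      rcases le_total n j with h | h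
      · simp [Nat.sub_eq_zero_of_le h]
      rcases le_total (n - j) s with h' | h'
      · simp [Nat.sub_eq_zero_of_le h']
      · obtain ⟨a, rfl⟩ := Nat.exists_eq_add_of_le h
        have : j + a - j = a := by omega
        rw [this] at h' ⊢
        obtain ⟨d, rfl⟩ := Nat.exists_eq_add_of_le h'
        have e1 : s + d - s = d := by omega
        have e2 : j + (s + d) - s = j + d := by omega
        rw [e1, e2]; nlinarith
    calc (n - j - s) * (n - j).descFactorial s * (n ^ s * n)
        = ((n - j - s) * n) * ((n - j).descFactorial s * n ^ s) := by ring
      _ ≤ ((n - j) * (n - s)) * ((n - j) ^ s * n.descFactorial s) := Nat.mul_le_mul h ih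
      _ = _ := by ring

lemma choose_sub_mul_pow_le (n j s : ℕ) :
    (n - j).choose s * n ^ s ≤ (n - j) ^ s * n.choose s := by
  have h := descFactorial_sub_mul_pow_le n j s
  rw [Nat.descFactorial_eq_factorial_mul_choose, Nat.descFactorial_eq_factorial_mul_choose] at h
  have : s.factorial * ((n - j).choose s * n ^ s) ≤
      s.factorial * ((n - j) ^ s * n.choose s) := by
    calc _ = s.factorial * (n - j).choose s * n ^ s := by ring
      _ ≤ _ := h
      _ = _ := by ring
  exact Nat.le_of_mul_le_mul_left this (Nat.factorial_pos s)

lemma choose_sub_le_exp_mul {n j s : ℕ} (hn : 0 < n) (hj : j ≤ n) :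
    ((n - j).choose s : ℝ) ≤ Real.exp (-(j * s / n)) * n.choose s := by
  have h : ((n - j).choose s : ℝ) * (n : ℝ) ^ s ≤ ((n : ℝ) - j) ^ s * n.choose s := by
    have := choose_sub_mul_pow_le n j s
    rw [← Nat.cast_sub hj]
    exact_mod_cast this
  have hn' : (0 : ℝ) < n := by exact_mod_cast hn
  have h2 : ((n : ℝ) - j) ^ s = (1 - j / n) ^ s * (n : ℝ) ^ s := by
    rw [← mul_pow]; congr 1; field_simp
  have h3 : (1 - (j : ℝ) / n) ^ s ≤ Real.exp (-(j * s / n)) := by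
    have e : Real.exp (-(j * s / n)) = Real.exp (-(j / n)) ^ s := by
      rw [← Real.exp_nat_mul]; congr 1; ring
    rw [e]
    have : (j : ℝ) / n ≤ 1 := by
      rw [div_le_one hn']; exact_mod_cast hj
    exact pow_le_pow_left₀ (by linarith) (Real.one_sub_le_exp_neg _) _
  have h4 : ((n - j).choose s : ℝ) ≤ (1 - (j : ℝ) / n) ^ s * n.choose s := by
    rw [h2] at h
    have hp : (0 : ℝ) < (n : ℝ) ^ s := by positivity
    nlinarith
  exact h4.trans (mul_le_mul_of_nonneg_right h3 (by positivity))

/-! ### Existence of an anytime confidence radius -/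

section Maximal

variable {Ω : Type*} [mΩ : MeasurableSpace Ω] {P : Measure Ω}

/-- Integrate `exp y ≥ y + 1`. This is the submartingale property needed in the maximal inequality.
-/
lemma one_le_lintegral_exp_of_integral_eq_zero [IsProbabilityMeasure P] {Y : Ω → ℝ} {l : ℝ}
    (hY : Integrable Y P) (h0 : ∫ ω, Y ω ∂P = 0)
    (he : Integrable (fun ω => Real.exp (l * Y ω)) P) :
    1 ≤ ∫⁻ ω, ENNReal.ofReal (Real.exp (l * Y ω)) ∂P := by
  rw [← ofReal_integral_eq_lintegral_ofReal he (ae_of_all _ fun ω => (Real.exp_pos _).le)]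
  rw [ENNReal.one_le_ofReal]
  calc (1 : ℝ) = ∫ ω, (l * Y ω + 1) ∂P := by
        rw [integral_add (hY.const_mul l) (integrable_const _), integral_const_mul, h0]; simp
    _ ≤ _ := integral_mono ((hY.const_mul l).add (integrable_const _)) he
        fun ω => Real.add_one_le_exp _

/-- Maximal inequality for sums of independent centred `1`-sub-Gaussian variables. -/
lemma measure_exists_le_sum_range_le [IsProbabilityMeasure P] {X : ℕ → Ω → ℝ}
    (hX : iIndepFun X P) (hm : ∀ i, Measurable (X i))
    (hs : ∀ i, HasSubgaussianMGF (X i) 1 P) (h0 : ∀ i, ∫ ω, X i ω ∂P = 0)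
    {N : ℕ} (hN : 1 ≤ N) {u : ℝ} (hu : 0 ≤ u) :
    P {ω | ∃ k ≤ N, u ≤ ∑ i ∈ Finset.range k, X i ω} ≤
      ENNReal.ofReal (Real.exp (-(u ^ 2 / (2 * N)))) := by
  have hN0 : (0 : ℝ) < N := by exact_mod_cast hN
  -- The tilt that minimises `N l² / 2 - l u`.
  set l : ℝ := u / N with hl
  have hl0 : 0 ≤ l := by positivity
  set S : ℕ → Ω → ℝ := fun k ω => ∑ i ∈ Finset.range k, X i ω with hS
  have hSm : ∀ k, Measurable (S k) := fun k => Finset.measurable_sum _ fun i _ => hm i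
  set E : ℕ → Set Ω := fun k => {ω | u ≤ S k ω ∧ ∀ i < k, S i ω < u} with hE
  have hEm : ∀ k, MeasurableSet (E k) := fun k => by
    refine (measurableSet_le measurable_const (hSm k)).inter ?_
    have : {ω | ∀ i < k, S i ω < u} = ⋂ i, ⋂ (_ : i < k), {ω | S i ω < u} := by ext; simp
    change MeasurableSet {ω | ∀ i < k, S i ω < u}
    rw [this]
    exact MeasurableSet.iInter fun i => MeasurableSet.iInter fun _ =>
      measurableSet_lt (hSm i) measurable_const
  have hEd : Pairwise (Function.onFun Disjoint E) := by
    intro a b hab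
    rw [Function.onFun, Set.disjoint_left]
    rintro ω ⟨h1, h2⟩ ⟨h3, h4⟩
    rcases lt_or_gt_of_ne hab with h | h
    · exact absurd h1 (not_le.2 (h4 a h))
    · exact absurd h3 (not_le.2 (h2 b h))
  have hcov : {ω | ∃ k ≤ N, u ≤ ∑ i ∈ Finset.range k, X i ω} ⊆
      ⋃ k ∈ Finset.range (N + 1), E k := by
    rintro ω ⟨k, hk, hku⟩
    classical
    have hex : ∃ k, u ≤ S k ω := ⟨k, hku⟩
    have hle : Nat.find hex ≤ k := Nat.find_min' hex hku
    exact Set.mem_iUnion₂.2 ⟨Nat.find hex, Finset.mem_range.2 (by omega), Nat.find_spec hex,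
      fun i hi => not_le.1 (Nat.find_min hex hi)⟩
  -- First-passage decomposition: on `E k` the sum first reaches `u` at time `k`. The remaining
  -- increment `D` is independent of the past and its exponential has mean at least one, so
  -- continuing up to `N` can only increase the integral over `E k`.
  have hstep : ∀ k ∈ Finset.range (N + 1), ENNReal.ofReal (Real.exp (l * u)) * P (E k) ≤
      ∫⁻ ω in E k, ENNReal.ofReal (Real.exp (l * S N ω)) ∂P := by
    intro k hk
    have hkN : k ≤ N := by simp at hk; omega
    set m : ℕ → MeasurableSpace Ω := fun i => MeasurableSpace.comap (X i) inferInstance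
    have hmle : ∀ i, m i ≤ mΩ := fun i => (hm i).comap_le
    have hind := indep_iSup_of_disjoint hmle hX
      (S := {i | i < k}) (T := {i | k ≤ i}) (by
        rw [Set.disjoint_left]; intro i h1 h2; simp at h1 h2; omega)
    have hSk : ∀ i ≤ k, Measurable[⨆ i ∈ {i | i < k}, m i] (S i) := fun i hi =>
      Finset.measurable_sum _ fun q hq => Measurable.mono (comap_measurable (X q))
        (le_iSup₂_of_le q (by simp at hq ⊢; omega) le_rfl) le_rfl
    set D : Ω → ℝ := fun ω => ∑ i ∈ Finset.Ico k N, X i ω with hD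
    have hDm : Measurable[⨆ i ∈ {i | k ≤ i}, m i] D :=
      Finset.measurable_sum _ fun q hq => Measurable.mono (comap_measurable (X q))
        (le_iSup₂_of_le q (by simp at hq ⊢; omega) le_rfl) le_rfl
    have hEk : MeasurableSet[⨆ i ∈ {i | i < k}, m i] (E k) := by
      refine @MeasurableSet.inter _ (⨆ i ∈ {i | i < k}, m i) _ _
        (hSk k le_rfl measurableSet_Ici) ?_
      have : {ω | ∀ i < k, S i ω < u} = ⋂ i, ⋂ (_ : i < k), {ω | S i ω < u} := by ext; simp
      change MeasurableSet[⨆ i ∈ {i | i < k}, m i] {ω | ∀ i < k, S i ω < u}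
      rw [this]
      exact MeasurableSet.iInter fun i => MeasurableSet.iInter fun hi =>
        hSk i hi.le measurableSet_Iio
    set f : Ω → ℝ≥0∞ := (E k).indicator fun ω => ENNReal.ofReal (Real.exp (l * S k ω)) with hf
    set g : Ω → ℝ≥0∞ := fun ω => ENNReal.ofReal (Real.exp (l * D ω)) with hg
    have hfm : Measurable[⨆ i ∈ {i | i < k}, m i] f :=
      Measurable.indicator (ENNReal.measurable_ofReal.comp
        (Real.measurable_exp.comp ((hSk k le_rfl).const_mul l))) hEk
    have hgm : Measurable[⨆ i ∈ {i | k ≤ i}, m i] g :=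
      ENNReal.measurable_ofReal.comp (Real.measurable_exp.comp (hDm.const_mul l))
    have hfg := lintegral_mul_eq_lintegral_mul_lintegral_of_independent_measurableSpace
      (iSup₂_le fun i _ => hmle i) (iSup₂_le fun i _ => hmle i) hind hfm hgm
    have hDsub : HasSubgaussianMGF D (∑ i ∈ Finset.Ico k N, 1) P :=
      HasSubgaussianMGF.sum_of_iIndepFun hX (c := fun _ => 1) fun i _ => hs i
    have hg1 : 1 ≤ ∫⁻ ω, g ω ∂P := by
      refine one_le_lintegral_exp_of_integral_eq_zero ?_ ?_ (hDsub.integrable_exp_mul l)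
      · exact integrable_finsetSum _ fun i _ => (hs i).integrable
      · rw [integral_finsetSum _ fun i _ => (hs i).integrable]
        simp [h0]
    have hfgS : ∀ ω, (f * g) ω = (E k).indicator
        (fun ω => ENNReal.ofReal (Real.exp (l * S N ω))) ω := by
      intro ω
      by_cases hω : ω ∈ E k
      · simp only [hf, hg, Pi.mul_apply, Set.indicator_of_mem hω]
        rw [← ENNReal.ofReal_mul (Real.exp_pos _).le, ← Real.exp_add, ← mul_add]
        congr 4
        exact Finset.sum_range_add_sum_Ico _ hkN
      · simp [hf, Set.indicator_of_notMem hω]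
    calc ENNReal.ofReal (Real.exp (l * u)) * P (E k)
        = ∫⁻ ω in E k, ENNReal.ofReal (Real.exp (l * u)) ∂P := by rw [setLIntegral_const]
      _ ≤ ∫⁻ ω in E k, ENNReal.ofReal (Real.exp (l * S k ω)) ∂P := by
          refine setLIntegral_mono' (hEm k) fun ω hω => ?_
          exact ENNReal.ofReal_le_ofReal (Real.exp_le_exp.2
            (mul_le_mul_of_nonneg_left hω.1 hl0))
      _ = ∫⁻ ω, f ω ∂P := (lintegral_indicator (hEm k) _).symm
      _ ≤ (∫⁻ ω, f ω ∂P) * ∫⁻ ω, g ω ∂P := le_mul_of_one_le_right' hg1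
      _ = ∫⁻ ω, (f * g) ω ∂P := hfg.symm
      _ = _ := by rw [lintegral_congr hfgS, lintegral_indicator (hEm k)]
  have hSN : HasSubgaussianMGF (S N) (∑ i ∈ Finset.range N, 1) P :=
    HasSubgaussianMGF.sum_of_iIndepFun hX (c := fun _ => 1) fun i _ => hs i
  have hmgf : ∫⁻ ω, ENNReal.ofReal (Real.exp (l * S N ω)) ∂P ≤
      ENNReal.ofReal (Real.exp (N * l ^ 2 / 2)) := by
    rw [← ofReal_integral_eq_lintegral_ofReal (hSN.integrable_exp_mul l)
      (ae_of_all _ fun ω => (Real.exp_pos _).le)]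
    refine ENNReal.ofReal_le_ofReal ?_
    have := hSN.mgf_le l
    simpa [mgf] using this
  have hsum : ENNReal.ofReal (Real.exp (l * u)) * P (⋃ k ∈ Finset.range (N + 1), E k) ≤
      ENNReal.ofReal (Real.exp (N * l ^ 2 / 2)) := by
    calc _ ≤ ENNReal.ofReal (Real.exp (l * u)) * ∑ k ∈ Finset.range (N + 1), P (E k) := by
          gcongr; exact measure_biUnion_finset_le _ _
      _ ≤ ∑ k ∈ Finset.range (N + 1), ∫⁻ ω in E k, ENNReal.ofReal (Real.exp (l * S N ω)) ∂P := by
          rw [Finset.mul_sum]; exact Finset.sum_le_sum hstep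
      _ = ∫⁻ ω in ⋃ k ∈ Finset.range (N + 1), E k, ENNReal.ofReal (Real.exp (l * S N ω)) ∂P :=
          (lintegral_biUnion_finset (fun a _ b _ hab => hEd hab) (fun k _ => hEm k) _).symm
      _ ≤ _ := (setLIntegral_le_lintegral _ _).trans hmgf
  refine (measure_mono hcov).trans ?_
  have hne : ENNReal.ofReal (Real.exp (l * u)) ≠ 0 := by
    simpa using Real.exp_pos _
  rw [mul_comm, ← ENNReal.le_div_iff_mul_le (Or.inl hne) (Or.inl ENNReal.ofReal_ne_top),
    ← ENNReal.ofReal_div_of_pos (Real.exp_pos _), ← Real.exp_sub] at hsum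
  refine hsum.trans (ENNReal.ofReal_le_ofReal (Real.exp_le_exp.2 (le_of_eq ?_)))
  rw [hl]; field_simp; ring

end Maximal

/-! ### Dyadic peeling and the admissible constant `5` -/

lemma add_one_le_three_mul_logOne {l k : ℕ} (h : 2 ^ l ≤ k) : (l : ℝ) + 1 ≤ 3 * logOne k := by
  have hk : (0 : ℝ) < k := by
    have := Nat.one_le_two_pow (n := l)
    exact_mod_cast (by omega : 0 < k)
  have h1 : ((2 : ℝ) ^ l) ≤ k := by exact_mod_cast h
  have h2 := Real.log_le_log (by positivity) h1
  rw [Real.log_pow] at h2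
  have h3 := Real.log_two_gt_d9
  have h4 := log_le_logOne (k : ℝ)
  have h5 := one_le_logOne (k : ℝ)
  have : (0 : ℝ) ≤ l := by positivity
  nlinarith

/-- The threshold of the dyadic block `[2 ^ l, 2 ^ (l + 1))` is below the confidence radius. -/
lemma block_threshold_le {α : ℝ} (hα : 0 < α) (hα1 : α < 1) {l k : ℕ} (hl : 2 ^ l ≤ k) :
    Real.sqrt (2 * (2 ^ (l + 1) : ℕ) * Real.log (2 * ((l + 1) * (l + 2)) / α)) ≤
      k * confRadius 5 k α := by
  have hk : (0 : ℝ) < k := by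
    have := Nat.one_le_two_pow (n := l)
    exact_mod_cast (by omega : 0 < k)
  have hg1 := one_le_logOne (k : ℝ)
  have hl1 := add_one_le_three_mul_logOne hl
  set g := logOne (k : ℝ) with hg
  have e1 : (k : ℝ) * confRadius 5 k α = Real.sqrt (25 * k * logOne (g / α)) := by
    unfold confRadius
    rw [show (25 : ℝ) * k * logOne (g / α) =
      (k * 5) ^ 2 * (1 / (k : ℝ) * logOne (g / α)) by field_simp; ring,
      Real.sqrt_mul (sq_nonneg _), Real.sqrt_sq (by positivity), mul_assoc]
  rw [e1]
  refine Real.sqrt_le_sqrt ?_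
  have h2k : (2 : ℝ) * (2 ^ (l + 1) : ℕ) ≤ 4 * k := by
    have : ((2 ^ l : ℕ) : ℝ) ≤ k := by exact_mod_cast hl
    push_cast at this ⊢
    rw [pow_succ]; linarith
  -- The `6` is `4 + 2`, from `log 36 ≤ 4` and the square of `g / α`. With the factor `4 k` this
  -- gives `24 ≤ 25 = 5²`, which is why the constant `5` suffices.
  have hlog : Real.log (2 * ((l + 1) * (l + 2)) / α) ≤ 6 * logOne (g / α) := by
    have hq : 1 ≤ 1 / α := by rw [le_div_iff₀ hα]; linarith
    have hle : 2 * (((l : ℝ) + 1) * (l + 2)) / α ≤ 36 * (g / α) ^ 2 := by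
      have : 2 * (((l : ℝ) + 1) * (l + 2)) ≤ 36 * g ^ 2 := by
        have : (0 : ℝ) ≤ l := by positivity
        nlinarith
      calc 2 * (((l : ℝ) + 1) * (l + 2)) / α ≤ 36 * g ^ 2 / α := by gcongr
        _ = 36 * g ^ 2 * (1 / α) := by ring
        _ ≤ 36 * g ^ 2 * (1 / α) * (1 / α) := le_mul_of_one_le_right (by positivity) hq
        _ = _ := by ring
    have hga : 0 < g / α := div_pos (by linarith) hα
    have h1 := Real.log_le_log (by positivity) hle
    rw [Real.log_mul (by norm_num) (by positivity), Real.log_pow] at h1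
    have h36 : Real.log 36 ≤ 4 := by
      rw [Real.log_le_iff_le_exp (by norm_num)]
      have h2 : (2.7 : ℝ) ≤ Real.exp 1 := by linarith [Real.exp_one_gt_d9]
      calc (36 : ℝ) ≤ 2.7 ^ 4 := by norm_num
        _ ≤ Real.exp 1 ^ 4 := pow_le_pow_left₀ (by norm_num) h2 4
        _ = Real.exp 4 := by rw [← Real.exp_nat_mul]; norm_num
    have h3 := log_le_logOne (g / α)
    have h4 := one_le_logOne (g / α)
    push_cast at h1
    linarith
  have hlog0 := logOne_pos (g / α)
  calc _ ≤ 2 * ((2 ^ (l + 1) : ℕ) : ℝ) * (6 * logOne (g / α)) := by gcongr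
    _ ≤ 4 * k * (6 * logOne (g / α)) := by gcongr
    _ ≤ _ := by nlinarith [mul_pos hk hlog0]

/-- Serves two union bounds: over the dyadic blocks of sample sizes and over the brackets. -/
lemma tsum_ofReal_telescoping {α : ℝ} (hα : 0 ≤ α) :
    ∑' l : ℕ, ENNReal.ofReal (α / (((l : ℝ) + 1) * (l + 2))) ≤ ENNReal.ofReal α := by
  refine ENNReal.tsum_le_of_sum_range_le fun n => ?_
  rw [← ENNReal.ofReal_sum_of_nonneg fun l _ => by positivity]
  refine ENNReal.ofReal_le_ofReal ?_
  have : ∀ n : ℕ, ∑ l ∈ Finset.range n, α / (((l : ℝ) + 1) * (l + 2)) = α - α / (n + 1) := by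
    intro n
    induction n with
    | zero => simp
    | succ n ih => rw [Finset.sum_range_succ, ih]; push_cast; field_simp; ring
  rw [this]
  have : 0 ≤ α / ((n : ℝ) + 1) := by positivity
  linarith

/-- Peeling: on each block of sample sizes from `2 ^ l` to `2 ^ (l + 1)` the maximal inequality is
applied to the centred sums and to their negatives, with error budget `α / ((l + 1) (l + 2))`; the
budgets sum to at most `α`. -/
theorem isAnytimeConstant_five : IsAnytimeConstant 5 := by
  intro ν _ hν α hα hα1
  set P := Measure.infinitePi (fun _ : ℕ => ν) with hP
  set a : ℝ := ∫ y, y ∂ν with ha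
  set X : ℕ → (ℕ → ℝ) → ℝ := fun i x => x i - a with hX
  have hXm : ∀ i, Measurable (X i) := fun i => by
    change Measurable fun x : ℕ → ℝ => x i - a
    fun_prop
  have hXi : iIndepFun X P := iIndepFun_infinitePi (X := fun _ x => x - a)
    fun _ => measurable_id.sub_const a
  have hmap : ∀ i : ℕ, P.map (fun x => x i) = ν := fun i => Measure.infinitePi_map_eval _ i
  have hXs : ∀ i, HasSubgaussianMGF (X i) 1 P := fun i => by
    have h1 : HasSubgaussianMGF (fun x => x - a) 1 (P.map fun x => x i) := by
      rw [hmap i]; exact hν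
    exact HasSubgaussianMGF.of_map (Y := fun x : ℕ → ℝ => x i)
      (measurable_pi_apply i).aemeasurable h1
  have hint : Integrable (fun y : ℝ => y) ν := by
    refine ((HasSubgaussianMGF.integrable hν).add (integrable_const a)).congr
      (ae_of_all _ fun y => ?_)
    simp [ha]
  have hX0 : ∀ i, ∫ x, X i x ∂P = 0 := fun i => by
    have : ∫ x, X i x ∂P = ∫ y, (y - a) ∂ν := by
      rw [← hmap i, integral_map (measurable_pi_apply i).aemeasurable]
      exact (measurable_id.sub_const a).aestronglyMeasurable
    rw [this, integral_sub hint (integrable_const a)]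
    simp [ha]
  have hnegi : iIndepFun (fun i => -X i) P := hXi.comp (fun _ x => -x) fun _ => measurable_neg
  have hneg0 : ∀ i, ∫ x, (-X i) x ∂P = 0 := fun i => by
    simp only [Pi.neg_apply]; rw [integral_neg, hX0, neg_zero]
  -- Chosen so that the maximal inequality over `2 ^ (l + 1)` steps gives exactly half the budget of
  -- block `l` for each sign.
  set u : ℕ → ℝ := fun l =>
    Real.sqrt (2 * (2 ^ (l + 1) : ℕ) * Real.log (2 * ((l + 1) * (l + 2)) / α)) with hu
  set B : ℕ → Set (ℕ → ℝ) := fun l =>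
    {x | ∃ k ≤ 2 ^ (l + 1), u l ≤ ∑ i ∈ Finset.range k, X i x} ∪
    {x | ∃ k ≤ 2 ^ (l + 1), u l ≤ ∑ i ∈ Finset.range k, (-X i) x} with hB
  have hexp : ∀ l : ℕ, Real.exp (-(u l ^ 2 / (2 * (2 ^ (l + 1) : ℕ)))) =
      α / (((l : ℝ) + 1) * (l + 2)) / 2 := by
    intro l
    have h1 : 1 ≤ 2 * (((l : ℝ) + 1) * (l + 2)) / α := by
      rw [le_div_iff₀ hα]
      have : (0 : ℝ) ≤ l := by positivity
      nlinarith
    have h2 : (0 : ℝ) < 2 * (2 ^ (l + 1) : ℕ) := by positivity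
    simp only [hu]
    rw [Real.sq_sqrt (mul_nonneg h2.le (Real.log_nonneg h1)), mul_div_cancel_left₀ _ h2.ne',
      Real.exp_neg, Real.exp_log (by linarith), inv_div]
    field_simp
  have hBle : ∀ l, P (B l) ≤ ENNReal.ofReal (α / (((l : ℝ) + 1) * (l + 2))) := by
    intro l
    refine (measure_union_le _ _).trans ?_
    have h1 := measure_exists_le_sum_range_le hXi hXm hXs hX0
      (Nat.one_le_two_pow (n := l + 1)) (Real.sqrt_nonneg _ : 0 ≤ u l)
    have h2 := measure_exists_le_sum_range_le hnegi (fun i => (hXm i).neg)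
      (fun i => (hXs i).neg) hneg0 (Nat.one_le_two_pow (n := l + 1))
      (Real.sqrt_nonneg _ : 0 ≤ u l)
    refine (add_le_add h1 h2).trans ?_
    rw [hexp, ← ENNReal.ofReal_add (by positivity) (by positivity), add_halves]
  have hBU : P (⋃ l, B l) ≤ ENNReal.ofReal α :=
    (measure_iUnion_le _).trans ((ENNReal.tsum_le_tsum hBle).trans
      (tsum_ofReal_telescoping hα.le))
  have hBm : MeasurableSet (⋃ l, B l) := by
    refine MeasurableSet.iUnion fun l => MeasurableSet.union ?_ ?_
    · have : {x | ∃ k ≤ 2 ^ (l + 1), u l ≤ ∑ i ∈ Finset.range k, X i x} =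
          ⋃ k, ⋃ (_ : k ≤ 2 ^ (l + 1)), {x | u l ≤ ∑ i ∈ Finset.range k, X i x} := by ext; simp
      rw [this]
      exact MeasurableSet.iUnion fun k => MeasurableSet.iUnion fun _ =>
        measurableSet_le measurable_const (Finset.measurable_sum _ fun i _ => hXm i)
    · have : {x | ∃ k ≤ 2 ^ (l + 1), u l ≤ ∑ i ∈ Finset.range k, (-X i) x} =
          ⋃ k, ⋃ (_ : k ≤ 2 ^ (l + 1)), {x | u l ≤ ∑ i ∈ Finset.range k, (-X i) x} := by
        ext; simp
      rw [this]
      exact MeasurableSet.iUnion fun k => MeasurableSet.iUnion fun _ =>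
        measurableSet_le measurable_const (Finset.measurable_sum _ fun i _ => (hXm i).neg)
  have hcompl : ENNReal.ofReal (1 - α) ≤ P (⋃ l, B l)ᶜ := by
    rw [prob_compl_eq_one_sub hBm, ENNReal.ofReal_sub _ hα.le, ENNReal.ofReal_one]
    gcongr
  refine hcompl.trans (measure_mono ?_)
  intro x hx k hk
  have hk0 : (0 : ℝ) < k := by exact_mod_cast hk
  set l := Nat.log 2 k
  have hl : 2 ^ l ≤ k := Nat.pow_log_le_self 2 (by omega)
  have hl' : k ≤ 2 ^ (l + 1) := (Nat.lt_pow_succ_log_self (by norm_num) k).le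
  have hx' : x ∉ B l := fun h => hx (Set.mem_iUnion.2 ⟨l, h⟩)
  have hb := block_threshold_le hα hα1 hl
  simp only [hB, Set.mem_union, Set.mem_ofPred_eq, not_or, not_exists, not_and, not_le] at hx'
  have h1 := hx'.1 k hl'
  have h2 := hx'.2 k hl'
  have hsum : ∑ i ∈ Finset.range k, X i x = (∑ i ∈ Finset.range k, x i) - k * a := by
    simp [hX, Finset.sum_sub_distrib]
  have hsum' : ∑ i ∈ Finset.range k, (-X i) x = -((∑ i ∈ Finset.range k, x i) - k * a) := by
    rw [← hsum]; simp
  rw [hsum] at h1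
  rw [hsum'] at h2
  have e : (∑ s ∈ Finset.range k, x s) / (k : ℝ) - a =
      ((∑ i ∈ Finset.range k, x i) - k * a) / k := by field_simp
  rw [e, abs_le]
  constructor
  · rw [le_div_iff₀ hk0]; nlinarith
  · rw [div_le_iff₀ hk0]; nlinarith

/-- A negative radius can never bound an absolute value, so the required event would be empty; the
Dirac mass at `0` is a distribution on which to see this. The sign is needed for monotonicity of the
radius in the level. -/
lemma IsAnytimeConstant.nonneg {C : ℝ} (hC : IsAnytimeConstant C) : 0 ≤ C := by
  by_contra h
  push Not at h
  have hsub : IsOneSubGaussian (Measure.dirac (0 : ℝ)) := by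
    unfold IsOneSubGaussian
    refine ⟨fun t => integrable_dirac (by simp), fun t => ?_⟩
    simp only [mgf, integral_dirac]
    simpa using by positivity
  have := hC (Measure.dirac 0) hsub (1 / 2) (by norm_num) (by norm_num)
  have hempty : {x : ℕ → ℝ | ∀ k : ℕ, 1 ≤ k →
      |(∑ s ∈ Finset.range k, x s) / (k : ℝ) - ∫ y, y ∂(Measure.dirac (0 : ℝ))| ≤
        confRadius C k (1 / 2)} = ∅ := by
    ext x
    simp only [Set.mem_ofPred_eq, Set.mem_empty_iff_false, iff_false, not_forall]
    refine ⟨1, le_rfl, fun hle => ?_⟩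
    have h1 : 0 ≤ confRadius C 1 (1 / 2) := (abs_nonneg _).trans hle
    unfold confRadius at h1
    have h2 : 0 < Real.sqrt (1 / ((1 : ℕ) : ℝ) * logOne (logOne ((1 : ℕ) : ℝ) / (1 / 2))) :=
      Real.sqrt_pos.2 (mul_pos (by norm_num) (logOne_pos _))
    nlinarith
  rw [hempty, measure_empty] at this
  norm_num at this

/-! ### Sizes of random subsets -/

lemma bracketSize_pos {n : ℕ} [NeZero n] (r : ℕ) : 0 < bracketSize n r :=
  lt_min (Nat.pos_of_ne_zero (NeZero.ne n)) (by positivity)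

lemma card_filter_mem_powersetCard_le {n s : ℕ} (i : Fin n) :
    ((Finset.powersetCard s (Finset.univ : Finset (Fin n))).filter (fun S => i ∈ S)).card ≤
      (n - 1).choose (s - 1) := by
  have h : (Finset.powersetCard (s - 1) (Finset.univ.erase i)).card = (n - 1).choose (s - 1) := by
    rw [Finset.card_powersetCard, Finset.card_erase_of_mem (Finset.mem_univ i), Finset.card_fin]
  rw [← h]
  refine Finset.card_le_card_of_injOn (fun S => S.erase i) ?_ ?_
  · intro S hS
    simp only [Finset.coe_filter, Finset.mem_powersetCard_univ, Set.mem_ofPred_eq] at hS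
    simp only [Finset.mem_coe, Finset.mem_powersetCard]
    exact ⟨Finset.erase_subset_erase _ (Finset.subset_univ _), by
      rw [Finset.card_erase_of_mem hS.2, hS.1]⟩
  · intro S hS T hT hST
    simp only [Finset.coe_filter, Finset.mem_powersetCard_univ, Set.mem_ofPred_eq] at hS hT
    have := congrArg (insert i) hST
    simpa only [Finset.insert_erase hS.2, Finset.insert_erase hT.2] using this

namespace BracketUCBRun

variable {n : ℕ} {C δ : ℝ} {ν : Fin n → Measure ℝ} {Ω : Type*} [mΩ : MeasurableSpace Ω]
  {P : Measure Ω}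

/-! ### The independent sources of randomness -/

/-- The `σ`-algebras generated by the brackets and by the single outcomes. -/
@[reducible]
def source (run : BracketUCBRun C δ ν P) : ℕ ⊕ (Fin n × ℕ × ℕ) → MeasurableSpace Ω :=
  Sum.elim (fun r : ℕ => MeasurableSpace.comap (run.A r) inferInstance)
    (fun q : Fin n × ℕ × ℕ => MeasurableSpace.comap (run.X q.1 q.2.1 q.2.2) inferInstance)

/-- The `σ`-algebra generated by a set of sources. -/
@[reducible]
def sources (run : BracketUCBRun C δ ν P) (S : Set (ℕ ⊕ (Fin n × ℕ × ℕ))) : MeasurableSpace Ω :=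
  ⨆ q ∈ S, run.source q

lemma source_le (run : BracketUCBRun C δ ν P) (q) : run.source q ≤ mΩ := by
  rcases q with r | q
  · exact (run.measurable_A r).comap_le
  · exact (run.measurable_X _ _ _).comap_le

lemma sources_le (run : BracketUCBRun C δ ν P) (S) : run.sources S ≤ mΩ :=
  iSup₂_le fun q _ => run.source_le q

lemma indep_sources (run : BracketUCBRun C δ ν P) {S T : Set (ℕ ⊕ (Fin n × ℕ × ℕ))}
    (h : Disjoint S T) : Indep (run.sources S) (run.sources T) P :=
  indep_iSup_of_disjoint run.source_le run.indep h

lemma measurable_A_sources (run : BracketUCBRun C δ ν P) {S : Set (ℕ ⊕ (Fin n × ℕ × ℕ))} {r : ℕ}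
    (h : Sum.inl r ∈ S) : Measurable[run.sources S] (run.A r) :=
  Measurable.mono (comap_measurable (run.A r))
    (le_iSup₂_of_le (f := fun q (_ : q ∈ S) => run.source q) (Sum.inl r) h le_rfl) le_rfl

lemma measurable_X_sources (run : BracketUCBRun C δ ν P) {S : Set (ℕ ⊕ (Fin n × ℕ × ℕ))}
    {i : Fin n} {r s : ℕ} (h : Sum.inr (i, r, s) ∈ S) : Measurable[run.sources S] (run.X i r s) :=
  Measurable.mono (comap_measurable (run.X i r s))
    (le_iSup₂_of_le (f := fun q (_ : q ∈ S) => run.source q) (Sum.inr (i, r, s)) h le_rfl) le_rfl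

lemma measurable_empMean_sources (run : BracketUCBRun C δ ν P) {S : Set (ℕ ⊕ (Fin n × ℕ × ℕ))}
    {i : Fin n} {r : ℕ} (h : ∀ s, Sum.inr (i, r, s) ∈ S) (k : ℕ) :
    Measurable[run.sources S] fun ω => empMean (fun i r s => run.X i r s ω) i r k := by
  unfold empMean
  exact (Finset.measurable_sum _ fun s _ => run.measurable_X_sources (h s)).div_const _

lemma measurable_ucb_sources (run : BracketUCBRun C δ ν P) {S : Set (ℕ ⊕ (Fin n × ℕ × ℕ))}
    {i : Fin n} {r : ℕ} (h : ∀ s, Sum.inr (i, r, s) ∈ S) (k : ℕ) :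
    Measurable[run.sources S] fun ω => ucb C δ (fun i r s => run.X i r s ω) i r k := by
  unfold ucb
  exact (run.measurable_empMean_sources h k).add_const _

/-- The sources that are outcomes. -/
def outcomes : Set (ℕ ⊕ (Fin n × ℕ × ℕ)) := Set.range Sum.inr

lemma inr_mem_outcomes (q : Fin n × ℕ × ℕ) : Sum.inr q ∈ (outcomes : Set (ℕ ⊕ (Fin n × ℕ × ℕ))) :=
  ⟨q, rfl⟩

/-- The outcome table contains the rewards of pulls that never happen, so events about it do not see
the adaptive sampling and are independent of the draw of the bracket. -/
lemma measure_inter_outcomes (run : BracketUCBRun C δ ν P) (r : ℕ) (𝒮 : Set (Finset (Fin n)))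
    {E : Set Ω} (hE : MeasurableSet[run.sources outcomes] E) :
    P ({ω | run.A r ω ∈ 𝒮} ∩ E) = P {ω | run.A r ω ∈ 𝒮} * P E := by
  have hd : Disjoint ({Sum.inl r} : Set (ℕ ⊕ (Fin n × ℕ × ℕ))) outcomes := by
    rw [Set.disjoint_left]
    rintro x hx ⟨q, rfl⟩
    simp at hx
  have hA : MeasurableSet[run.sources {Sum.inl r}] {ω | run.A r ω ∈ 𝒮} :=
    run.measurable_A_sources (Set.mem_singleton _) (Set.to_countable 𝒮).measurableSet
  exact (Indep_iff _ _ _).1 (run.indep_sources hd) _ _ hA hE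

lemma lintegral_indicator_outcomes (run : BracketUCBRun C δ ν P) (r : ℕ) (𝒮 : Set (Finset (Fin n)))
    {Y : Ω → ℝ≥0∞} (hY : Measurable[run.sources outcomes] Y) :
    ∫⁻ ω, {ω | run.A r ω ∈ 𝒮}.indicator Y ω ∂P = P {ω | run.A r ω ∈ 𝒮} * ∫⁻ ω, Y ω ∂P := by
  have hd : Disjoint ({Sum.inl r} : Set (ℕ ⊕ (Fin n × ℕ × ℕ))) outcomes := by
    rw [Set.disjoint_left]
    rintro x hx ⟨q, rfl⟩
    simp at hx
  have hA : MeasurableSet[run.sources {Sum.inl r}] {ω | run.A r ω ∈ 𝒮} :=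
    run.measurable_A_sources (Set.mem_singleton _) (Set.to_countable 𝒮).measurableSet
  have h1 : Measurable[run.sources {Sum.inl r}]
      ({ω | run.A r ω ∈ 𝒮}.indicator fun _ => (1 : ℝ≥0∞)) :=
    Measurable.indicator measurable_const hA
  have := lintegral_mul_eq_lintegral_mul_lintegral_of_independent_measurableSpace
    (run.sources_le _) (run.sources_le _) (run.indep_sources hd) h1 hY
  rw [lintegral_indicator (run.sources_le _ _ hA), setLIntegral_const, one_mul] at this
  rw [← this]
  refine lintegral_congr fun ω => ?_
  by_cases h : ω ∈ {ω | run.A r ω ∈ 𝒮}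
  · simp only [Set.indicator_of_mem h, one_mul]
  · simp only [Set.indicator_of_notMem h, zero_mul]

/-! ### The law of a bracket -/

lemma measure_A_mem (run : BracketUCBRun C δ ν P) {r : ℕ} (hr : 1 ≤ r)
    (p : Finset (Fin n) → Prop) [DecidablePred p] :
    P {ω | p (run.A r ω)} ≤
      (((Finset.powersetCard (bracketSize n r) Finset.univ).filter p).card : ℝ≥0∞) *
        ((n.choose (bracketSize n r) : ℕ) : ℝ≥0∞)⁻¹ := by
  have hsub : {ω | p (run.A r ω)} ⊆
      ⋃ S ∈ (Finset.powersetCard (bracketSize n r) Finset.univ).filter p,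
        {ω | run.A r ω = S} := by
    intro ω hω
    exact Set.mem_iUnion₂.2 ⟨run.A r ω, Finset.mem_filter.2
      ⟨Finset.mem_powersetCard_univ.2 (run.card_A r hr ω), hω⟩, rfl⟩
  refine (measure_mono hsub).trans ((measure_biUnion_finset_le _ _).trans ?_)
  rw [Finset.sum_congr rfl fun S hS => run.uniform_A r hr S
    (Finset.mem_powersetCard_univ.1 (Finset.mem_filter.1 hS).1), Finset.sum_const, nsmul_eq_mul]

/-- Of the `n.choose s` subsets of size `s`, at most `(n - 1).choose (s - 1)` contain `i`; the
quotient is `s / n`. -/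
lemma measure_mem_A_le [NeZero n] (run : BracketUCBRun C δ ν P) {r : ℕ} (hr : 1 ≤ r) (i : Fin n) :
    P {ω | i ∈ run.A r ω} ≤ ENNReal.ofReal (bracketSize n r / n) := by
  set s := bracketSize n r with hs
  have hs0 : 0 < s := bracketSize_pos r
  have hsn : s ≤ n := min_le_left _ _
  have hn : 0 < n := Nat.pos_of_ne_zero (NeZero.ne n)
  have hch : 0 < n.choose s := Nat.choose_pos hsn
  refine (run.measure_A_mem hr (fun S => i ∈ S)).trans ?_
  rw [← div_eq_mul_inv]
  calc _ ≤ (((n - 1).choose (s - 1) : ℕ) : ℝ≥0∞) / ((n.choose s : ℕ) : ℝ≥0∞) := by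
        gcongr; exact card_filter_mem_powersetCard_le i
    _ = ENNReal.ofReal ((n - 1).choose (s - 1) / n.choose s) := by
        rw [ENNReal.ofReal_div_of_pos (by exact_mod_cast hch), ENNReal.ofReal_natCast,
          ENNReal.ofReal_natCast]
    _ = _ := by
        congr 1
        have h := Nat.add_one_mul_choose_eq (n - 1) (s - 1)
        rw [Nat.sub_add_cancel hn, Nat.sub_add_cancel hs0] at h
        have h' : (n : ℝ) * (n - 1).choose (s - 1) = n.choose s * s := by exact_mod_cast h
        have : (0 : ℝ) < n.choose s := by exact_mod_cast hch
        have : (0 : ℝ) < n := by exact_mod_cast hn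
        field_simp
        linarith

/-- A bracket of size at least `4 n / (j + 1)` misses the best `j + 1` arms with probability at
most `exp (-4)`. -/
lemma measure_A_miss_le [NeZero n] (run : BracketUCBRun C δ ν P) {r : ℕ} (hr : 1 ≤ r) (j : Fin n)
    (hj : 4 * n ≤ (j + 1) * 2 ^ r) :
    P {ω | ∀ i ∈ run.A r ω, j < i} ≤ ENNReal.ofReal (Real.exp (-4)) := by
  set s := bracketSize n r with hs
  have hs0 : 0 < s := bracketSize_pos r
  have hsn : s ≤ n := min_le_left _ _
  have hn : 0 < n := Nat.pos_of_ne_zero (NeZero.ne n)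
  have hch : 0 < n.choose s := Nat.choose_pos hsn
  have hch' : (0 : ℝ) < n.choose s := by exact_mod_cast hch
  classical
  have hcard : ((Finset.powersetCard s (Finset.univ : Finset (Fin n))).filter
      (fun S => ∀ i ∈ S, j < i)).card ≤ (n - (j + 1)).choose s := by
    have h2 : (Finset.powersetCard s (Finset.Ioi j)).card = (n - (j + 1)).choose s := by
      rw [Finset.card_powersetCard, Fin.card_Ioi]
      congr 1
      omega
    rw [← h2]
    refine Finset.card_le_card fun S hS => ?_
    rw [Finset.mem_filter, Finset.mem_powersetCard_univ] at hS
    rw [Finset.mem_powersetCard]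
    exact ⟨fun i hi => Finset.mem_Ioi.2 (hS.2 i hi), hS.1⟩
  refine (run.measure_A_mem hr (fun S => ∀ i ∈ S, j < i)).trans ?_
  rw [← div_eq_mul_inv]
  calc _ ≤ (((n - (j + 1)).choose s : ℕ) : ℝ≥0∞) / ((n.choose s : ℕ) : ℝ≥0∞) := by gcongr
    _ = ENNReal.ofReal ((n - (j + 1)).choose s / n.choose s) := by
        rw [ENNReal.ofReal_div_of_pos hch', ENNReal.ofReal_natCast, ENNReal.ofReal_natCast]
    _ ≤ _ := by
        refine ENNReal.ofReal_le_ofReal ?_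
        rw [div_le_iff₀ hch']
        rcases le_total n (2 ^ r) with h | h
        · have : s = n := min_eq_left h
          rw [Nat.choose_eq_zero_of_lt (by omega)]
          simp only [Nat.cast_zero]
          positivity
        · have hs2 : s = 2 ^ r := min_eq_right h
          refine (choose_sub_le_exp_mul hn (by omega : (j : ℕ) + 1 ≤ n)).trans ?_
          refine mul_le_mul_of_nonneg_right (Real.exp_le_exp.2 ?_) hch'.le
          rw [neg_le_neg_iff, le_div_iff₀ (by exact_mod_cast hn), hs2]
          exact_mod_cast hj

/-! ### Concentration of the empirical means -/

section Concentration

lemma iIndepFun_X (run : BracketUCBRun C δ ν P) (i : Fin n) (r : ℕ) :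
    iIndepFun (fun s => run.X i r s) P := by
  have := run.indep.precomp (g := fun s : ℕ => (Sum.inr (i, r, s) : ℕ ⊕ (Fin n × ℕ × ℕ)))
    (fun a b h => by simpa using h)
  exact this

variable [IsProbabilityMeasure P]

/-- The outcomes of one arm in one bracket have the infinite product law, so the defining property
of `C` carries over to the run. -/
lemma measure_exists_confRadius_lt [∀ i, IsProbabilityMeasure (ν i)]
    (hC : IsAnytimeConstant C) (hν : ∀ i, IsOneSubGaussian (ν i))
    (run : BracketUCBRun C δ ν P) (i : Fin n) (r : ℕ) {α : ℝ} (hα : 0 < α) (hα1 : α < 1) :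
    P {ω | ∃ k, 1 ≤ k ∧ confRadius C k α <
      |empMean (fun i r s => run.X i r s ω) i r k - ∫ y, y ∂(ν i)|} ≤ ENNReal.ofReal α := by
  have hmap : P.map (fun ω s => run.X i r s ω) = Measure.infinitePi fun _ : ℕ => ν i := by
    rw [(iIndepFun_iff_map_fun_eq_infinitePi_map fun s => run.measurable_X i r s).1
      (run.iIndepFun_X i r)]
    simp_rw [run.law_X]
  have hm : Measurable fun ω (s : ℕ) => run.X i r s ω :=
    measurable_pi_lambda _ fun s => run.measurable_X i r s
  set G := {x : ℕ → ℝ | ∀ k : ℕ, 1 ≤ k →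
    |(∑ s ∈ Finset.range k, x s) / (k : ℝ) - ∫ y, y ∂(ν i)| ≤ confRadius C k α} with hG
  have hGm : MeasurableSet G := by
    have : G = ⋂ k : ℕ, ⋂ (_ : 1 ≤ k), {x : ℕ → ℝ |
      |(∑ s ∈ Finset.range k, x s) / (k : ℝ) - ∫ y, y ∂(ν i)| ≤ confRadius C k α} := by
      ext; simp [hG]
    rw [this]
    refine MeasurableSet.iInter fun k => MeasurableSet.iInter fun _ =>
      measurableSet_le ?_ measurable_const
    refine Measurable.abs (Measurable.sub_const (Measurable.div_const ?_ _) _)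
    exact Finset.measurable_sum _ fun s _ => measurable_pi_apply s
  have h := hC (ν i) (hν i) α hα hα1
  rw [← hmap, Measure.map_apply hm hGm] at h
  have hset : {ω | ∃ k, 1 ≤ k ∧ confRadius C k α <
      |empMean (fun i r s => run.X i r s ω) i r k - ∫ y, y ∂(ν i)|} =
      ((fun ω (s : ℕ) => run.X i r s ω) ⁻¹' G)ᶜ := by
    ext ω
    simp [hG, empMean]
  rw [hset, prob_compl_eq_one_sub (hm hGm)]
  calc 1 - P ((fun ω (s : ℕ) => run.X i r s ω) ⁻¹' G) ≤ 1 - ENNReal.ofReal (1 - α) := by gcongr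
    _ = ENNReal.ofReal α := by
      rw [← ENNReal.ofReal_one, ← ENNReal.ofReal_sub _ (by linarith)]; congr 1; ring

lemma measure_le_empMean_sub (hν : ∀ i, IsOneSubGaussian (ν i))
    (run : BracketUCBRun C δ ν P) (i : Fin n) (r : ℕ) {k : ℕ} (hk : 1 ≤ k) {d : ℝ} (hd : 0 ≤ d) :
    P {ω | d ≤ empMean (fun i r s => run.X i r s ω) i r k - ∫ y, y ∂(ν i)} ≤
      ENNReal.ofReal (Real.exp (-(d ^ 2 / 2)) ^ k) := by
  have hk0 : (0 : ℝ) < k := by exact_mod_cast hk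
  set a := ∫ y, y ∂(ν i) with ha
  have hind : iIndepFun (fun s ω => run.X i r s ω - a) P :=
    (run.iIndepFun_X i r).comp (fun _ x => x - a) fun _ => measurable_id.sub_const a
  have hs : ∀ s, HasSubgaussianMGF (fun ω => run.X i r s ω - a) 1 P := fun s => by
    have h1 : HasSubgaussianMGF (fun x => x - a) 1 (P.map (run.X i r s)) := by
      rw [run.law_X]; exact hν i
    exact HasSubgaussianMGF.of_map (run.measurable_X i r s).aemeasurable h1
  have h := HasSubgaussianMGF.measure_sum_range_ge_le_of_iIndepFun hind (c := 1) (n := k)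
    (fun s _ => hs s) (ε := k * d) (by positivity)
  have hset : {ω | d ≤ empMean (fun i r s => run.X i r s ω) i r k - a} =
      {ω | k * d ≤ ∑ s ∈ Finset.range k, (run.X i r s ω - a)} := by
    ext ω
    have e : empMean (fun i r s => run.X i r s ω) i r k - a =
        (∑ s ∈ Finset.range k, (run.X i r s ω - a)) / k := by
      unfold empMean; rw [Finset.sum_sub_distrib]; simp; field_simp
    rw [Set.mem_ofPred_eq, Set.mem_ofPred_eq, e, le_div_iff₀ hk0, mul_comm]
  rw [hset, ← ofReal_measureReal]
  refine ENNReal.ofReal_le_ofReal (h.trans (le_of_eq ?_))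
  rw [← Real.exp_nat_mul]
  congr 1
  simp only [NNReal.coe_one]
  field_simp

end Concentration

end BracketUCBRun

/-! ### Pulls inside one bracket -/

/-- The level `δ / (|A_r| r²)` of the lower confidence bounds in bracket `r`. -/
def bracketLevel (n : ℕ) (δ : ℝ) (r : ℕ) : ℝ := δ / ((bracketSize n r : ℝ) * (r : ℝ) ^ 2)

lemma bracketLevel_pos {n : ℕ} [NeZero n] {δ : ℝ} (hδ : 0 < δ) {r : ℕ} (hr : 1 ≤ r) :
    0 < bracketLevel n δ r := by
  have h1 : (0 : ℝ) < bracketSize n r := by exact_mod_cast bracketSize_pos r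
  have h2 : (0 : ℝ) < r := by exact_mod_cast hr
  unfold bracketLevel; positivity

lemma bracketLevel_le {n : ℕ} [NeZero n] {δ : ℝ} (hδ : 0 < δ) {r : ℕ} (hr : 1 ≤ r) :
    bracketLevel n δ r ≤ δ := by
  have h1 : (1 : ℝ) ≤ bracketSize n r := by exact_mod_cast bracketSize_pos r
  have h2 : (1 : ℝ) ≤ r := by exact_mod_cast hr
  refine div_le_self hδ.le ?_
  nlinarith

/-- With `k` samples the arm `i` is not yet certified to be better than `b` at level `α`. -/
def Unresolved {n : ℕ} (C α : ℝ) (μ : Fin n → ℝ) (b i : Fin n) (k : ℕ) : Prop :=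
  ∃ k', k ≤ k' ∧ μ i - 2 * confRadius C k' α ≤ μ b

/-- After `k` pulls in bracket `r`, the arm `i` can be pulled once more although an arm at least
as good as `j` with a valid upper confidence bound is available and `i` is unresolved. -/
def CanBePulled {n : ℕ} (C δ : ℝ) (μ : Fin n → ℝ) (b j : Fin n) (x : Fin n → ℕ → ℕ → ℝ)
    (i : Fin n) (r k : ℕ) : Prop :=
  1 ≤ k ∧ μ j ≤ ucb C δ x i r k ∧ Unresolved C (bracketLevel n δ r) μ b i k

open Classical in
/-- An upper bound on the number of pulls of arm `i` in bracket `r`. -/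
def pullBound {n : ℕ} (C δ : ℝ) (μ : Fin n → ℝ) (b j : Fin n) (x : Fin n → ℕ → ℕ → ℝ)
    (i : Fin n) (r : ℕ) : ℝ≥0∞ :=
  1 + ∑' k : ℕ, if CanBePulled C δ μ b j x i r k then 1 else 0

/-- The gap that governs the number of pulls of arm `i`. -/
def armGap {n : ℕ} (μ : Fin n → ℝ) (b j i : Fin n) : ℝ :=
  if i < b then max (μ i) (μ j) - μ b else μ j - μ i

/-- The confidence level that governs the number of pulls of arm `i`. -/
def armLevel {n : ℕ} (δ : ℝ) (b i : Fin n) (r : ℕ) : ℝ :=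
  if i < b then bracketLevel n δ r else δ

lemma armLevel_pos {n : ℕ} [NeZero n] {δ : ℝ} (hδ : 0 < δ) (b i : Fin n) {r : ℕ} (hr : 1 ≤ r) :
    0 < armLevel δ b i r := by
  unfold armLevel; split_ifs
  exacts [bracketLevel_pos hδ hr, hδ]

lemma armLevel_le {n : ℕ} [NeZero n] {δ : ℝ} (hδ : 0 < δ) (b i : Fin n) {r : ℕ} (hr : 1 ≤ r) :
    armLevel δ b i r ≤ δ := by
  unfold armLevel; split_ifs
  exacts [bracketLevel_le hδ hr, le_rfl]

/-- For a bad arm, an upper bound above `μ j` with radius below an eighth of the gap already means a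
large deviation, so level `δ` suffices. For an arm before `b`, being unresolved gives `μ i - μ b` at
most a quarter of the gap; this is impossible if `μ i ≥ μ j`, and otherwise leaves `μ j - μ i` at
least three quarters of it. Only this second case uses the finer level `δ / (|A_r| r²)`, hence the
factor `n / j` in the first sum of `Hbest` only. -/
lemma le_empMean_sub_of_canBePulled {n : ℕ} {C δ : ℝ} (hC : 0 ≤ C)
    {μ : Fin n → ℝ} {b j i : Fin n} {x : Fin n → ℕ → ℕ → ℝ} {r k : ℕ}
    (hα : 0 < armLevel δ b i r) (hαδ : armLevel δ b i r ≤ δ)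
    (hgap : 0 < armGap μ b j i)
    (hU : ∀ k', k ≤ k' → confRadius C k' (armLevel δ b i r) < armGap μ b j i / 8)
    (h : CanBePulled C δ μ b j x i r k) : armGap μ b j i / 4 ≤ empMean x i r k - μ i := by
  obtain ⟨-, h1, k', hk', h2⟩ := h
  have h3 := confRadius_anti_level hC k hα hαδ
  have h4 := hU k le_rfl
  have h5 := hU k' hk'
  unfold ucb at h1
  unfold armGap armLevel at *
  split_ifs at * with hb
  · rcases le_total (μ i) (μ j) with h | h
    · rw [max_eq_right h] at *; linarith
    · rw [max_eq_left h] at *; linarith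
  · linarith

lemma inv_one_sub_exp_le {y : ℝ} (hy : 0 < y) (hy1 : y ≤ 1) :
    (1 - ENNReal.ofReal (Real.exp (-y)))⁻¹ ≤ ENNReal.ofReal (2 / y) := by
  have h : y / 2 ≤ 1 - Real.exp (-y) := by
    have h1 : (1 + y) * Real.exp (-y) ≤ 1 := by
      have := Real.add_one_le_exp y
      calc (1 + y) * Real.exp (-y) ≤ Real.exp y * Real.exp (-y) := by
            have := Real.exp_pos (-y); nlinarith
        _ = 1 := by rw [← Real.exp_add]; simp
    have := Real.exp_pos (-y)
    nlinarith
  rw [← ENNReal.ofReal_one, ← ENNReal.ofReal_sub _ (Real.exp_pos _).le,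
    ← ENNReal.ofReal_inv_of_pos (by linarith)]
  refine ENNReal.ofReal_le_ofReal ?_
  rw [← inv_div]
  exact inv_anti₀ (by positivity) h

lemma measurable_one_add_tsum {α : Type*} (m : MeasurableSpace α) {f : ℕ → α → ℝ≥0∞}
    (hf : ∀ k, Measurable[m] (f k)) : Measurable[m] fun a => 1 + ∑' k, f k a :=
  Measurable.const_add (Measurable.tsum hf) 1

namespace BracketUCBRun

variable {n : ℕ} {C δ : ℝ} {ν : Fin n → Measure ℝ} {Ω : Type*} [mΩ : MeasurableSpace Ω]
  {P : Measure Ω}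

/-- The table of outcomes. -/
def table (run : BracketUCBRun C δ ν P) (ω : Ω) : Fin n → ℕ → ℕ → ℝ := fun i r s => run.X i r s ω

lemma measurableSet_canBePulled (run : BracketUCBRun C δ ν P) {S : Set (ℕ ⊕ (Fin n × ℕ × ℕ))}
    (μ : Fin n → ℝ) (b j i : Fin n) (r k : ℕ) (h : ∀ s, Sum.inr (i, r, s) ∈ S) :
    MeasurableSet[run.sources S] {ω | CanBePulled C δ μ b j (run.table ω) i r k} := by
  have h1 : MeasurableSet[run.sources S] {ω | μ j ≤ ucb C δ (run.table ω) i r k} :=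
    run.measurable_ucb_sources h k measurableSet_Ici
  by_cases hc : 1 ≤ k ∧ Unresolved C (bracketLevel n δ r) μ b i k
  · have : {ω | CanBePulled C δ μ b j (run.table ω) i r k} =
        {ω | μ j ≤ ucb C δ (run.table ω) i r k} := by
      ext ω; simp [CanBePulled, hc]
    rwa [this]
  · have : {ω | CanBePulled C δ μ b j (run.table ω) i r k} = ∅ := by
      ext ω
      simp only [CanBePulled, Set.mem_ofPred_eq, Set.mem_empty_iff_false, iff_false]
      tauto
    rw [this]; exact @MeasurableSet.empty _ (run.sources S)

lemma measurable_pullBound (run : BracketUCBRun C δ ν P) {S : Set (ℕ ⊕ (Fin n × ℕ × ℕ))}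
    (μ : Fin n → ℝ) (b j i : Fin n) (r : ℕ) (h : ∀ s, Sum.inr (i, r, s) ∈ S) :
    Measurable[run.sources S] fun ω => pullBound C δ μ b j (run.table ω) i r := by
  unfold pullBound
  exact measurable_one_add_tsum (run.sources S) fun k =>
    Measurable.ite (run.measurableSet_canBePulled μ b j i r k h) measurable_const measurable_const

section PullBound

variable [IsProbabilityMeasure P]

/-- The expected number of pulls of an arm in a bracket. -/
lemma lintegral_pullBound_le [NeZero n] (hC : 0 ≤ C) {K : ℝ} (hK1 : 1 ≤ K)
    (hK : ∀ x α : ℝ, 1 ≤ x → 0 < α → α ≤ 1 → ∀ k : ℕ, K * (x * logOne (logOne x / α)) ≤ k →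
      ∀ d : ℝ, 0 < d → x = 1 / d ^ 2 → confRadius C k α < d / 8)
    (hν : ∀ i, IsOneSubGaussian (ν i)) (hδ : 0 < δ) (hδ1 : δ ≤ 1)
    (run : BracketUCBRun C δ ν P) {μ : Fin n → ℝ} (hμ : ∀ i, μ i = ∫ y, y ∂(ν i))
    (b j i : Fin n) {r : ℕ} (hr : 1 ≤ r) (hgap : 0 < armGap μ b j i) (hgap1 : armGap μ b j i ≤ 1) :
    ∫⁻ ω, pullBound C δ μ b j (run.table ω) i r ∂P ≤
      ENNReal.ofReal ((K + 67) * (1 / armGap μ b j i ^ 2 *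
        logOne (logOne (1 / armGap μ b j i ^ 2) / armLevel δ b i r))) := by
  set d := armGap μ b j i with hd
  set α := armLevel δ b i r with hα
  have hα0 : 0 < α := armLevel_pos hδ b i hr
  have hαδ : α ≤ δ := armLevel_le hδ b i hr
  set x := 1 / d ^ 2 with hx
  have hx1 : 1 ≤ x := by
    rw [hx, le_div_iff₀ (by positivity)]; nlinarith
  set L := logOne (logOne x / α) with hL
  have hL1 : 1 ≤ L := one_le_logOne _
  set k₀ := ⌈K * (x * L)⌉₊ with hk₀
  set q := Real.exp (-((d / 4) ^ 2 / 2)) with hq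
  have hprob : ∀ k, P {ω | CanBePulled C δ μ b j (run.table ω) i r k} ≤
      (if k ∈ Finset.range k₀ then 1 else 0) + ENNReal.ofReal q ^ k := by
    intro k
    by_cases hk : k < k₀
    · rw [if_pos (Finset.mem_range.2 hk)]
      exact prob_le_one.trans le_self_add
    · rw [if_neg (by simpa using hk), zero_add, ← ENNReal.ofReal_pow (Real.exp_pos _).le]
      push Not at hk
      rcases Nat.eq_zero_or_pos k with rfl | hk1
      · simpa using prob_le_one
      have hkk : K * (x * L) ≤ k := (Nat.le_ceil _).trans (by exact_mod_cast hk)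
      refine (measure_mono ?_).trans
        (run.measure_le_empMean_sub hν i r hk1 (d := d / 4) (by positivity))
      intro ω hω
      rw [Set.mem_ofPred_eq, ← hμ]
      refine le_empMean_sub_of_canBePulled hC hα0 hαδ hgap (fun k' hk' => ?_) hω
      exact hK x α hx1 hα0 (hαδ.trans hδ1) k' (hkk.trans (by exact_mod_cast hk')) d hgap rfl
  have hm : ∀ k, MeasurableSet {ω | CanBePulled C δ μ b j (run.table ω) i r k} := fun k =>
    run.sources_le _ _ (run.measurableSet_canBePulled (S := outcomes) μ b j i r k
      fun s => inr_mem_outcomes _)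
  have hint : ∫⁻ ω, pullBound C δ μ b j (run.table ω) i r ∂P =
      1 + ∑' k, P {ω | CanBePulled C δ μ b j (run.table ω) i r k} := by
    unfold pullBound
    rw [lintegral_add_left measurable_const, lintegral_const, measure_univ, mul_one,
      lintegral_tsum fun k => (Measurable.ite (hm k) measurable_const
        measurable_const).aemeasurable]
    congr 2
    funext k
    rw [← lintegral_indicator_one (hm k)]
    refine lintegral_congr fun ω => ?_
    by_cases h : CanBePulled C δ μ b j (run.table ω) i r k
    · rw [if_pos h, Set.indicator_of_mem (by exact h), Pi.one_apply]
    · rw [if_neg h, Set.indicator_of_notMem (by exact h)]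
  rw [hint]
  -- Here `q = exp (-y)` with `y = d² / 32`, so `2 / y = 64 x`. The `67` in the conclusion covers
  -- this, the initial pull and the rounding up of `k₀`.
  have hgeo : ∑' k : ℕ, ENNReal.ofReal q ^ k ≤ ENNReal.ofReal (64 * x) := by
    rw [ENNReal.tsum_geometric]
    refine (inv_one_sub_exp_le (by positivity) (by nlinarith)).trans (le_of_eq ?_)
    congr 1
    rw [hx]; field_simp; norm_num
  have hfin : ∑' k : ℕ, (if k ∈ Finset.range k₀ then 1 else 0 : ℝ≥0∞) = k₀ := by
    rw [tsum_eq_sum (s := Finset.range k₀) fun k hk => if_neg hk]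
    rw [Finset.sum_congr rfl fun k hk => if_pos hk]
    simp
  calc 1 + ∑' k, P {ω | CanBePulled C δ μ b j (run.table ω) i r k}
      ≤ 1 + ((k₀ : ℝ≥0∞) + ENNReal.ofReal (64 * x)) := by
        gcongr
        refine (ENNReal.tsum_le_tsum hprob).trans ?_
        rw [ENNReal.tsum_add, hfin]
        gcongr
    _ = ENNReal.ofReal (1 + (k₀ + 64 * x)) := by
        rw [ENNReal.ofReal_add (by norm_num) (by positivity),
          ENNReal.ofReal_add (by positivity) (by positivity), ENNReal.ofReal_one,
          ENNReal.ofReal_natCast]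
    _ ≤ _ := by
        refine ENNReal.ofReal_le_ofReal ?_
        have h1 : (k₀ : ℝ) < K * (x * L) + 1 := Nat.ceil_lt_add_one (by positivity)
        have h2 : x ≤ x * L := le_mul_of_one_le_right (by linarith) hL1
        nlinarith

end PullBound

/-! ### Good brackets -/

/-- A bracket is good if it contains one of the arms up to `j` with an upper confidence bound that
is valid at all times, and if it resolves after few pulls. -/
def goodBracket (run : BracketUCBRun C δ ν P) (μ : Fin n → ℝ) (b j : Fin n) (r : ℕ) (N : ℝ≥0∞) :
    Set Ω :=
  {ω | ∃ i ∈ run.A r ω, i ≤ j ∧ ∀ k, 1 ≤ k → μ i ≤ ucb C δ (run.table ω) i r k} ∩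
    {ω | ∑ i ∈ run.A r ω, pullBound C δ μ b j (run.table ω) i r ≤ N}

/-- The sources that belong to the brackets in `R`. -/
def ofBrackets (R : Set ℕ) : Set (ℕ ⊕ (Fin n × ℕ × ℕ)) :=
  {q | Sum.elim id (fun q : Fin n × ℕ × ℕ => q.2.1) q ∈ R}

lemma sum_mem_A_eq (run : BracketUCBRun C δ ν P) (r : ℕ) (Y : Fin n → Ω → ℝ≥0∞) (ω : Ω) :
    ∑ i ∈ run.A r ω, Y i ω =
      ∑ i, ({ω | run.A r ω ∈ {S : Finset (Fin n) | i ∈ S}}.indicator (Y i)) ω := by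
  classical
  simp only [Set.indicator_apply, Set.mem_ofPred_eq, Finset.sum_ite_mem, Finset.univ_inter]

lemma measurableSet_valid (run : BracketUCBRun C δ ν P) {S : Set (ℕ ⊕ (Fin n × ℕ × ℕ))}
    (μ : Fin n → ℝ) (i : Fin n) (r : ℕ) (h : ∀ s, Sum.inr (i, r, s) ∈ S) :
    MeasurableSet[run.sources S] {ω | ∀ k, 1 ≤ k → μ i ≤ ucb C δ (run.table ω) i r k} := by
  have : {ω | ∀ k, 1 ≤ k → μ i ≤ ucb C δ (run.table ω) i r k} =
      ⋂ k, ⋂ (_ : 1 ≤ k), {ω | μ i ≤ ucb C δ (run.table ω) i r k} := by ext; simp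
  rw [this]
  exact MeasurableSet.iInter fun k => MeasurableSet.iInter fun _ =>
    run.measurable_ucb_sources h k measurableSet_Ici

lemma measurableSet_goodBracket (run : BracketUCBRun C δ ν P) (μ : Fin n → ℝ) (b j : Fin n)
    (r : ℕ) (N : ℝ≥0∞) {R : Set ℕ} (hr : r ∈ R) :
    MeasurableSet[run.sources (ofBrackets R)] (run.goodBracket μ b j r N) := by
  have hA : ∀ i : Fin n, MeasurableSet[run.sources (ofBrackets R)]
      {ω | run.A r ω ∈ {S : Finset (Fin n) | i ∈ S}} := fun i =>
    run.measurable_A_sources (S := ofBrackets R) hr (Set.to_countable _).measurableSet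
  refine @MeasurableSet.inter _ (run.sources (ofBrackets R)) _ _ ?_ ?_
  · have : {ω | ∃ i ∈ run.A r ω, i ≤ j ∧ ∀ k, 1 ≤ k → μ i ≤ ucb C δ (run.table ω) i r k} =
        ⋃ i, ⋃ (_ : i ≤ j), {ω | run.A r ω ∈ {S : Finset (Fin n) | i ∈ S}} ∩
          {ω | ∀ k, 1 ≤ k → μ i ≤ ucb C δ (run.table ω) i r k} := by
      ext ω
      simp only [Set.mem_ofPred_eq, Set.mem_iUnion, Set.mem_inter_iff]
      exact exists_congr fun i => by tauto
    rw [this]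
    exact MeasurableSet.iUnion fun i => MeasurableSet.iUnion fun _ =>
      @MeasurableSet.inter _ (run.sources (ofBrackets R)) _ _ (hA i)
        (run.measurableSet_valid μ i r fun s => hr)
  · have hm : Measurable[run.sources (ofBrackets R)] fun ω =>
        ∑ i ∈ run.A r ω, pullBound C δ μ b j (run.table ω) i r := by
      simp_rw [run.sum_mem_A_eq r fun i ω => pullBound C δ μ b j (run.table ω) i r]
      exact Finset.measurable_sum _ fun i _ =>
        Measurable.indicator (run.measurable_pullBound μ b j i r fun s => hr) (hA i)
    exact hm measurableSet_Iic

/-- Membership of `i` in the bracket and the pull bound of `i` come from disjoint sources, so the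
expectation of their product factorises. -/
lemma lintegral_sum_pullBound_le [NeZero n] (run : BracketUCBRun C δ ν P) (μ : Fin n → ℝ)
    (b j : Fin n) {r : ℕ} (hr : 1 ≤ r) :
    ∫⁻ ω, ∑ i ∈ run.A r ω, pullBound C δ μ b j (run.table ω) i r ∂P ≤
      ∑ i, ENNReal.ofReal (bracketSize n r / n) *
        ∫⁻ ω, pullBound C δ μ b j (run.table ω) i r ∂P := by
  have hY : ∀ i, Measurable[run.sources outcomes]
      fun ω => pullBound C δ μ b j (run.table ω) i r := fun i =>
    run.measurable_pullBound μ b j i r fun s => inr_mem_outcomes _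
  have hA : ∀ i : Fin n, MeasurableSet {ω | run.A r ω ∈ {S : Finset (Fin n) | i ∈ S}} := fun i =>
    run.measurable_A r (Set.to_countable _).measurableSet
  simp_rw [run.sum_mem_A_eq r fun i ω => pullBound C δ μ b j (run.table ω) i r]
  rw [lintegral_finsetSum _ fun i _ =>
    Measurable.indicator ((hY i).mono (run.sources_le _) le_rfl) (hA i)]
  refine Finset.sum_le_sum fun i _ => ?_
  rw [run.lintegral_indicator_outcomes r _ (hY i)]
  gcongr
  exact run.measure_mem_A_le hr i

section Good

variable [IsProbabilityMeasure P] [∀ i, IsProbabilityMeasure (ν i)] [NeZero n]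

omit [NeZero n] in
lemma measure_not_valid_le (hC : IsAnytimeConstant C) (hν : ∀ i, IsOneSubGaussian (ν i))
    (hδ : 0 < δ) (hδ1 : δ < 1) (run : BracketUCBRun C δ ν P) {μ : Fin n → ℝ}
    (hμ : ∀ i, μ i = ∫ y, y ∂(ν i)) (i : Fin n) (r : ℕ) :
    P {ω | ∀ k, 1 ≤ k → μ i ≤ ucb C δ (run.table ω) i r k}ᶜ ≤ ENNReal.ofReal δ := by
  refine (measure_mono ?_).trans (run.measure_exists_confRadius_lt hC hν i r hδ hδ1)
  intro ω hω
  simp only [Set.mem_compl_iff, Set.mem_ofPred_eq, not_forall, not_le] at hω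
  obtain ⟨k, hk, h⟩ := hω
  refine ⟨k, hk, ?_⟩
  rw [← hμ]
  unfold ucb at h
  refine lt_of_lt_of_le ?_ (neg_le_abs _)
  change confRadius C k δ < -(empMean (run.table ω) i r k - μ i)
  linarith

omit [NeZero n] in
-- Only the upper bound of the best arm of the bracket has to be valid. Which arm this is depends on
-- the bracket alone, hence is independent of the outcomes; conditioning on it costs a single `δ` in
-- place of a union bound over the bracket, so the upper bounds can be used at level `δ`.
lemma measure_invalid_leader_le (hC : IsAnytimeConstant C) (hν : ∀ i, IsOneSubGaussian (ν i))
    (hδ : 0 < δ) (hδ1 : δ < 1) (run : BracketUCBRun C δ ν P) {μ : Fin n → ℝ}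
    (hμ : ∀ i, μ i = ∫ y, y ∂(ν i)) (r : ℕ) :
    P (⋃ i, {ω | run.A r ω ∈ {S : Finset (Fin n) | i ∈ S ∧ ∀ i' ∈ S, i ≤ i'}} ∩
      {ω | ∀ k, 1 ≤ k → μ i ≤ ucb C δ (run.table ω) i r k}ᶜ) ≤ ENNReal.ofReal δ := by
  set 𝒮 : Fin n → Set (Finset (Fin n)) := fun i => {S | i ∈ S ∧ ∀ i' ∈ S, i ≤ i'}
  have hdis : Pairwise (Function.onFun Disjoint fun i => {ω | run.A r ω ∈ 𝒮 i}) := by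
    intro a c hac
    rw [Function.onFun, Set.disjoint_left]
    rintro ω ⟨h1, h2⟩ ⟨h3, h4⟩
    exact hac (le_antisymm (h2 _ h3) (h4 _ h1))
  have hsum : ∑ i, P {ω | run.A r ω ∈ 𝒮 i} ≤ 1 := by
    rw [← tsum_fintype (L := SummationFilter.unconditional _), ← measure_iUnion hdis fun i =>
      run.measurable_A r (Set.to_countable (𝒮 i)).measurableSet]
    exact prob_le_one
  calc _ ≤ ∑ i, P ({ω | run.A r ω ∈ 𝒮 i} ∩
        {ω | ∀ k, 1 ≤ k → μ i ≤ ucb C δ (run.table ω) i r k}ᶜ) := by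
        exact measure_iUnion_fintype_le _ _
    _ ≤ ∑ i, P {ω | run.A r ω ∈ 𝒮 i} * ENNReal.ofReal δ := by
        refine Finset.sum_le_sum fun i _ => ?_
        rw [run.measure_inter_outcomes r (𝒮 i)
          (run.measurableSet_valid μ i r fun s => inr_mem_outcomes _).compl]
        gcongr
        exact run.measure_not_valid_le hC hν hδ hδ1 hμ i r
    _ ≤ ENNReal.ofReal δ := by
        rw [← Finset.sum_mul]
        exact mul_le_of_le_one_left' hsum

/-- A sufficiently large bracket fails to be good with probability at most `1 / 16`. -/
lemma measure_goodBracket_compl_le (hC : IsAnytimeConstant C) (hν : ∀ i, IsOneSubGaussian (ν i))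
    (hδ : 0 < δ) (hδ1 : δ ≤ 0.025) (run : BracketUCBRun C δ ν P) {μ : Fin n → ℝ}
    (hμ : ∀ i, μ i = ∫ y, y ∂(ν i)) (b j : Fin n) {r : ℕ} (hr : 1 ≤ r)
    (hj : 4 * n ≤ (j + 1) * 2 ^ r) {N : ℝ} (hN : 0 < N)
    (hNle : ∑ i, ENNReal.ofReal (bracketSize n r / n) *
        ∫⁻ ω, pullBound C δ μ b j (run.table ω) i r ∂P ≤ ENNReal.ofReal (N / 100)) :
    P (run.goodBracket μ b j r (ENNReal.ofReal N))ᶜ ≤ ENNReal.ofReal (1 / 16) := by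
  set Y : Ω → ℝ≥0∞ := fun ω => ∑ i ∈ run.A r ω, pullBound C δ μ b j (run.table ω) i r with hY
  have hYm : Measurable Y := by
    simp_rw [hY, run.sum_mem_A_eq r fun i ω => pullBound C δ μ b j (run.table ω) i r]
    exact Finset.measurable_sum _ fun i _ => Measurable.indicator
      ((run.measurable_pullBound (S := outcomes) μ b j i r fun s => inr_mem_outcomes _).mono
        (run.sources_le _) le_rfl) (run.measurable_A r (Set.to_countable _).measurableSet)
  have hsub : (run.goodBracket μ b j r (ENNReal.ofReal N))ᶜ ⊆
      ({ω | ∀ i ∈ run.A r ω, j < i} ∪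
      (⋃ i, {ω | run.A r ω ∈ {S : Finset (Fin n) | i ∈ S ∧ ∀ i' ∈ S, i ≤ i'}} ∩
        {ω | ∀ k, 1 ≤ k → μ i ≤ ucb C δ (run.table ω) i r k}ᶜ)) ∪
      {ω | ENNReal.ofReal N ≤ Y ω} := by
    intro ω hω
    by_contra hcon
    simp only [Set.mem_union, not_or] at hcon
    obtain ⟨⟨h1, h2⟩, h3⟩ := hcon
    refine hω ⟨?_, ?_⟩
    · simp only [Set.mem_ofPred_eq, not_forall, not_lt] at h1
      obtain ⟨i, hi, hij⟩ := h1
      have hne : (run.A r ω).Nonempty := ⟨i, hi⟩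
      refine ⟨(run.A r ω).min' hne, Finset.min'_mem _ _, (Finset.min'_le _ _ hi).trans hij, ?_⟩
      by_contra hv
      exact h2 (Set.mem_iUnion.2 ⟨_, ⟨Finset.min'_mem _ hne, fun i' hi' =>
        Finset.min'_le _ _ hi'⟩, hv⟩)
    · simp only [Set.mem_ofPred_eq, not_le] at h3
      exact h3.le
  have hexp : Real.exp (-4) ≤ 1 / 50 := by
    rw [Real.exp_neg, ← one_div]
    refine one_div_le_one_div_of_le (by norm_num) ?_
    have h2 : (2.7 : ℝ) ≤ Real.exp 1 := by linarith [Real.exp_one_gt_d9]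
    calc (50 : ℝ) ≤ 2.7 ^ 4 := by norm_num
      _ ≤ Real.exp 1 ^ 4 := pow_le_pow_left₀ (by norm_num) h2 4
      _ = Real.exp 4 := by rw [← Real.exp_nat_mul]; norm_num
  have hmarkov : P {ω | ENNReal.ofReal N ≤ Y ω} ≤ ENNReal.ofReal (1 / 100) := by
    refine (meas_ge_le_lintegral_div hYm.aemeasurable (by simpa using hN)
      ENNReal.ofReal_ne_top).trans ?_
    rw [ENNReal.div_le_iff (by simpa using hN) ENNReal.ofReal_ne_top,
      ← ENNReal.ofReal_mul (by norm_num)]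
    refine ((run.lintegral_sum_pullBound_le μ b j hr).trans hNle).trans (le_of_eq ?_)
    congr 1; ring
  -- Missing the arms up to `j`, an invalid leader, and Markov's inequality: `0.055` in total. The
  -- threshold `δ ≤ 0.025` leaves room below `1 / 16`, which has to beat the growth `8 ^ s` of the
  -- horizons.
  calc _ ≤ (ENNReal.ofReal (1 / 50) + ENNReal.ofReal 0.025) + ENNReal.ofReal (1 / 100) := by
        refine (measure_mono hsub).trans ((measure_union_le _ _).trans (add_le_add
          ((measure_union_le _ _).trans (add_le_add ?_ ?_)) hmarkov))
        · exact (run.measure_A_miss_le hr j hj).trans (ENNReal.ofReal_le_ofReal hexp)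
        · exact (run.measure_invalid_leader_le hC hν hδ (by linarith) hμ r).trans
            (ENNReal.ofReal_le_ofReal hδ1)
    _ ≤ _ := by
        rw [← ENNReal.ofReal_add (by norm_num) (by norm_num),
          ← ENNReal.ofReal_add (by norm_num) (by norm_num)]
        exact ENNReal.ofReal_le_ofReal (by norm_num)

omit [∀ i, IsProbabilityMeasure (ν i)] [NeZero n] in
/-- Different brackets are good or not independently of each other. -/
lemma measure_iInter_goodBracket_compl_le (run : BracketUCBRun C δ ν P) (μ : Fin n → ℝ)
    (b j : Fin n) (N : ℕ → ℝ≥0∞) (r₀ : ℕ) (p : ℝ≥0∞)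
    (h : ∀ r, r₀ ≤ r → P (run.goodBracket μ b j r (N r))ᶜ ≤ p) (s : ℕ) :
    P (⋂ q ∈ Finset.range s, (run.goodBracket μ b j (r₀ + q) (N (r₀ + q)))ᶜ) ≤ p ^ s := by
  induction s with
  | zero => simp
  | succ s ih =>
    have hset : (⋂ q ∈ Finset.range (s + 1),
        (run.goodBracket μ b j (r₀ + q) (N (r₀ + q)))ᶜ) =
        (⋂ q ∈ Finset.range s, (run.goodBracket μ b j (r₀ + q) (N (r₀ + q)))ᶜ) ∩
          (run.goodBracket μ b j (r₀ + s) (N (r₀ + s)))ᶜ := by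
      rw [Finset.range_add_one, Finset.set_biInter_insert, Set.inter_comm]
    -- Independence across brackets relies on samples not being shared: each outcome belongs to
    -- exactly one bracket.
    have hd : Disjoint (ofBrackets (n := n) (Set.Iio (r₀ + s))) (ofBrackets {r₀ + s}) := by
      rw [Set.disjoint_left]
      intro q h1 h2
      simp only [ofBrackets, Set.mem_ofPred_eq, Set.mem_Iio, Set.mem_singleton_iff] at h1 h2
      omega
    have hm1 : MeasurableSet[run.sources (ofBrackets (Set.Iio (r₀ + s)))]
        (⋂ q ∈ Finset.range s, (run.goodBracket μ b j (r₀ + q) (N (r₀ + q)))ᶜ) :=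
      Finset.measurableSet_biInter _ fun q hq => (run.measurableSet_goodBracket μ b j _ _
        (by simp at hq ⊢; omega)).compl
    have hm2 : MeasurableSet[run.sources (ofBrackets {r₀ + s})]
        (run.goodBracket μ b j (r₀ + s) (N (r₀ + s)))ᶜ :=
      (run.measurableSet_goodBracket μ b j _ _ (Set.mem_singleton _)).compl
    rw [hset, (Indep_iff _ _ _).1 (run.indep_sources hd) _ _ hm1 hm2, pow_succ]
    exact mul_le_mul' ih (h _ (by omega))

end Good

end BracketUCBRun

/-! ### Pull counts along a realization -/

lemma pullCount_mono {n : ℕ} (p : ℕ → Fin n) (i : Fin n) (r : ℕ) :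
    Monotone (pullCount p i r) := fun _ _ h =>
  Finset.card_le_card (Finset.filter_subset_filter _ (Finset.Icc_subset_Icc_right h))

lemma pullCount_succ {n : ℕ} (p : ℕ → Fin n) (i : Fin n) (r t : ℕ) :
    pullCount p i r (t + 1) = pullCount p i r t +
      if activeBracket (t + 1) = r ∧ p (t + 1) = i then 1 else 0 := by
  unfold pullCount
  rw [← Finset.insert_Icc_right_eq_Icc_add_one (by omega), Finset.filter_insert]
  split_ifs with h
  · rw [Finset.card_insert_of_notMem (by simp)]
  · simp

lemma exists_pull_of_lt_pullCount {n : ℕ} {p : ℕ → Fin n} {i : Fin n} {r t k : ℕ}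
    (h : k < pullCount p i r t) :
    ∃ s, 1 ≤ s ∧ s ≤ t ∧ activeBracket s = r ∧ p s = i ∧ pullCount p i r (s - 1) = k := by
  induction t with
  | zero => simp [pullCount] at h
  | succ t ih =>
    by_cases hk : k < pullCount p i r t
    · obtain ⟨s, h1, h2, h3⟩ := ih hk
      exact ⟨s, h1, by omega, h3⟩
    · rw [pullCount_succ] at h
      split_ifs at h with hc
      · exact ⟨t + 1, by omega, le_rfl, hc.1, hc.2, by simp only [Nat.add_sub_cancel]; omega⟩
      · omega

/-- Immediate because `Unresolved` quantifies over all later sample sizes; thus certification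
persists without monotonicity of the radius in the number of samples. -/
lemma Unresolved.anti {n : ℕ} {C α : ℝ} {μ : Fin n → ℝ} {b i : Fin n} {k l : ℕ} (h : k ≤ l)
    (hl : Unresolved C α μ b i l) : Unresolved C α μ b i k := by
  obtain ⟨k', h1, h2⟩ := hl
  exact ⟨k', h.trans h1, h2⟩

/-- At the end of round `t`, some arm has enough samples in some open bracket to be certified to be
better than `b` from now on. -/
def Certified {n : ℕ} (C δ : ℝ) (μ : Fin n → ℝ) (b : Fin n) (p : ℕ → Fin n) (t : ℕ) : Prop :=
  ∃ r, 1 ≤ r ∧ r ≤ openBrackets t ∧ ∃ i, 1 ≤ pullCount p i r t ∧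
    ¬ Unresolved C (bracketLevel n δ r) μ b i (pullCount p i r t)

lemma Certified.mono {n : ℕ} {C δ : ℝ} {μ : Fin n → ℝ} {b : Fin n} {p : ℕ → Fin n} {s t : ℕ}
    (h : s ≤ t) (hs : Certified C δ μ b p s) : Certified C δ μ b p t := by
  obtain ⟨r, h1, h2, i, h3, h4⟩ := hs
  exact ⟨r, h1, h2.trans (openBrackets_mono h), i, h3.trans (pullCount_mono p i r h),
    fun hu => h4 (hu.anti (pullCount_mono p i r h))⟩

lemma le_pullBound {n : ℕ} {C δ : ℝ} {μ : Fin n → ℝ} {b j i : Fin n}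
    {x : Fin n → ℕ → ℕ → ℝ} {r T : ℕ}
    (h : ∀ k, 1 ≤ k → k < T → CanBePulled C δ μ b j x i r k) :
    (T : ℝ≥0∞) ≤ pullBound C δ μ b j x i r := by
  classical
  have h1 : ((T - 1 : ℕ) : ℝ≥0∞) ≤ ∑' k : ℕ, if CanBePulled C δ μ b j x i r k then 1 else 0 := by
    refine le_trans ?_ (ENNReal.sum_le_tsum (Finset.Ico 1 T))
    rw [Finset.sum_congr rfl fun k hk => if_pos (h k (Finset.mem_Ico.1 hk).1
      (Finset.mem_Ico.1 hk).2)]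
    simp
  calc (T : ℝ≥0∞) ≤ ((1 + (T - 1) : ℕ) : ℝ≥0∞) := by exact_mod_cast (by omega : T ≤ 1 + (T - 1))
    _ = 1 + ((T - 1 : ℕ) : ℝ≥0∞) := by push_cast; rfl
    _ ≤ _ := by unfold pullBound; gcongr

namespace BracketUCBRun

variable {n : ℕ} {C δ : ℝ} {ν : Fin n → Measure ℝ} {Ω : Type*} [mΩ : MeasurableSpace Ω]
  {P : Measure Ω}

/-- The arms pulled along a realization. -/
def pulls (run : BracketUCBRun C δ ν P) (ω : Ω) : ℕ → Fin n := fun s => run.I s ω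

lemma mem_A_of_pullCount_pos (run : BracketUCBRun C δ ν P) {ω : Ω} {i : Fin n} {r t : ℕ}
    (h : 1 ≤ pullCount (run.pulls ω) i r t) : i ∈ run.A r ω := by
  obtain ⟨s, h1, -, rfl, rfl, -⟩ := exists_pull_of_lt_pullCount h
  exact (run.pull_rule s h1 ω).1

lemma bracketRounds_eq_sum (run : BracketUCBRun C δ ν P) (ω : Ω) (r t : ℕ) :
    bracketRounds r t = ∑ i ∈ run.A r ω, pullCount (run.pulls ω) i r t := by
  unfold bracketRounds
  rw [Finset.card_eq_sum_card_fiberwise (f := run.pulls ω) (t := run.A r ω)]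
  · refine Finset.sum_congr rfl fun i _ => ?_
    rw [Finset.filter_filter]; rfl
  · intro s hs
    simp only [Finset.coe_filter, Finset.mem_Icc, Set.mem_ofPred_eq] at hs
    have := (run.pull_rule s hs.1.1 ω).1
    rw [hs.2] at this
    exact this

/-- Look at the round in which `i`, already pulled `k ≥ 1` times, is pulled again. The sampling rule
then guarantees that no arm of the bracket is unsampled, so the valid arm competes, and the maximal
upper bound is at least its mean, hence at least `μ j`. Unresolvedness at the later count passes
down to `k`. -/
lemma canBePulled_of_not_certified (run : BracketUCBRun C δ ν P) {μ : Fin n → ℝ}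
    (hμ : Antitone μ) {b j : Fin n} {ω : Ω} {r t : ℕ} (hr : 1 ≤ r) (hrt : r ≤ openBrackets t)
    (hg : ∃ i ∈ run.A r ω, i ≤ j ∧ ∀ k, 1 ≤ k → μ i ≤ ucb C δ (run.table ω) i r k)
    (hc : ¬ Certified C δ μ b (run.pulls ω) t) {i : Fin n} {k : ℕ} (hk : 1 ≤ k)
    (hkT : k < pullCount (run.pulls ω) i r t) : CanBePulled C δ μ b j (run.table ω) i r k := by
  refine ⟨hk, ?_, ?_⟩
  · obtain ⟨s, hs1, hst, hsr, hsi, hsk⟩ := exists_pull_of_lt_pullCount hkT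
    obtain ⟨-, h2, h3⟩ := run.pull_rule s hs1 ω
    obtain ⟨i₀, hi₀, hij, hv⟩ := hg
    change (∃ i ∈ run.A (activeBracket s) ω,
      pullCount (run.pulls ω) i (activeBracket s) (s - 1) = 0) →
      pullCount (run.pulls ω) (run.pulls ω s) (activeBracket s) (s - 1) = 0 at h2
    change (∀ i ∈ run.A (activeBracket s) ω,
      pullCount (run.pulls ω) i (activeBracket s) (s - 1) ≠ 0) →
      ∀ i ∈ run.A (activeBracket s) ω,
        ucb C δ (run.table ω) i (activeBracket s)
          (pullCount (run.pulls ω) i (activeBracket s) (s - 1)) ≤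
        ucb C δ (run.table ω) (run.pulls ω s) (activeBracket s)
          (pullCount (run.pulls ω) (run.pulls ω s) (activeBracket s) (s - 1)) at h3
    rw [hsr, hsi, hsk] at h2 h3
    have hall : ∀ i ∈ run.A r ω, pullCount (run.pulls ω) i r (s - 1) ≠ 0 := fun i hi h0 => by
      have := h2 ⟨i, hi, h0⟩; omega
    exact (hμ hij).trans ((hv _ (Nat.one_le_iff_ne_zero.2 (hall i₀ hi₀))).trans
      (h3 hall i₀ hi₀))
  · by_contra hu
    exact hc ⟨r, hr, hrt, i, by omega, fun hu' => hu (hu'.anti hkT.le)⟩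

lemma bracketRounds_le_of_goodBracket (run : BracketUCBRun C δ ν P) {μ : Fin n → ℝ}
    (hμ : Antitone μ) {b j : Fin n} {ω : Ω} {r t : ℕ} {N : ℝ≥0∞} (hr : 1 ≤ r)
    (hrt : r ≤ openBrackets t) (hg : ω ∈ run.goodBracket μ b j r N)
    (hc : ¬ Certified C δ μ b (run.pulls ω) t) : (bracketRounds r t : ℝ≥0∞) ≤ N := by
  rw [run.bracketRounds_eq_sum ω, Nat.cast_sum]
  exact (Finset.sum_le_sum fun i _ => le_pullBound fun k hk hkT =>
    run.canBePulled_of_not_certified hμ hr hrt hg.1 hc hk hkT).trans hg.2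

/-! ### The stopping time -/

open Classical in
/-- The first round at the end of which some arm is certified to be better than `b`. -/
def certTime (run : BracketUCBRun C δ ν P) (μ : Fin n → ℝ) (b : Fin n) (ω : Ω) : WithTop ℕ :=
  if h : ∃ t, Certified C δ μ b (run.pulls ω) t then ((Nat.find h : ℕ) : WithTop ℕ) else ⊤

lemma certTime_le_iff (run : BracketUCBRun C δ ν P) (μ : Fin n → ℝ) (b : Fin n) (ω : Ω) (t : ℕ) :
    run.certTime μ b ω ≤ (t : WithTop ℕ) ↔ Certified C δ μ b (run.pulls ω) t := by
  classical
  unfold certTime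
  split_ifs with h
  · rw [Nat.cast_le]
    exact ⟨fun hle => (Nat.find_spec h).mono hle, fun hc => Nat.find_min' h hc⟩
  · simp only [top_le_iff, WithTop.natCast_ne_top, false_iff]
    exact fun hc => h ⟨t, hc⟩

lemma measurable_I_history (run : BracketUCBRun C δ ν P) {s t : ℕ} (hs : 1 ≤ s) (hst : s ≤ t) :
    Measurable[run.history t] (run.I s) := by
  have h1 : Measurable[MeasurableSpace.comap (fun ω => (run.I s ω, run.obs s ω, run.O s ω))
      inferInstance] (run.I s) := measurable_fst.comp (comap_measurable _)
  exact h1.mono (le_iSup₂_of_le (f := fun s (_ : s ∈ Finset.Icc 1 t) =>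
    MeasurableSpace.comap (fun ω => (run.I s ω, run.obs s ω, run.O s ω)) inferInstance)
    s (Finset.mem_Icc.2 ⟨hs, hst⟩) le_rfl) le_rfl

lemma measurable_pullCount_history (run : BracketUCBRun C δ ν P) (i : Fin n) (r t : ℕ) :
    Measurable[run.history t] fun ω => pullCount (run.pulls ω) i r t := by
  simp only [pullCount, Finset.card_filter]
  refine Finset.measurable_sum _ fun s hs => ?_
  rw [Finset.mem_Icc] at hs
  refine Measurable.ite ?_ measurable_const measurable_const
  exact @MeasurableSet.inter _ (run.history t) _ _ (@MeasurableSet.const _ (run.history t) _)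
    (run.measurable_I_history hs.1 hs.2 (measurableSet_singleton i))

/-- Certification is a condition on the pull counts alone, with deterministic thresholds, and is
monotone in time. -/
lemma isStoppingTime_certTime (run : BracketUCBRun C δ ν P) (μ : Fin n → ℝ) (b : Fin n) :
    IsStoppingTime run.history (run.certTime μ b) := by
  intro t
  have : {ω | run.certTime μ b ω ≤ (t : WithTop ℕ)} =
      ⋃ r, ⋃ (_ : 1 ≤ r ∧ r ≤ openBrackets t), ⋃ i,
        (fun ω => pullCount (run.pulls ω) i r t) ⁻¹'
          {k | 1 ≤ k ∧ ¬ Unresolved C (bracketLevel n δ r) μ b i k} := by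
    ext ω
    rw [Set.mem_ofPred_eq, certTime_le_iff]
    simp [Certified, and_assoc]
  change MeasurableSet[run.history t] {ω | run.certTime μ b ω ≤ ((t : ℕ) : WithTop ℕ)}
  rw [this]
  exact MeasurableSet.iUnion fun r => MeasurableSet.iUnion fun _ => MeasurableSet.iUnion fun i =>
    run.measurable_pullCount_history i r t (Set.to_countable _).measurableSet

/-! ### Correctness of the recommendations -/

/-- Some arm of bracket `r` violates the confidence radius at the level of the lower bounds. -/
def radiusFails (run : BracketUCBRun C δ ν P) (μ : Fin n → ℝ) (i : Fin n) (r : ℕ) : Set Ω :=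
  {ω | run.A r ω ∈ {S : Finset (Fin n) | i ∈ S}} ∩
    {ω | ∃ k, 1 ≤ k ∧ confRadius C k (bracketLevel n δ r) <
      |empMean (run.table ω) i r k - μ i|}

/-- Chain: `μ b` is below the mean of the certified arm minus two radii, which is at most its lower
bound, then the lower bound of the recommendation, then the mean of the recommendation. The two arms
may come from different brackets. -/
lemma lt_recommended_of_certified (run : BracketUCBRun C δ ν P) {μ : Fin n → ℝ} {b : Fin n}
    {ω : Ω} {t : ℕ} (ht : 1 ≤ t) (hc : Certified C δ μ b (run.pulls ω) t)
    (hω : ∀ r, 1 ≤ r → ∀ i, ω ∉ run.radiusFails μ i r) : μ b < μ (run.O t ω) := by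
  obtain ⟨r, hr, hrt, i, hi, hu⟩ := hc
  obtain ⟨r', hr', -, ho, hoT, hmax⟩ := run.recommend_rule t ht ω
  have hle := hmax r hr hrt i (run.mem_A_of_pullCount_pos hi) hi
  have hfine : ∀ r, 1 ≤ r → ∀ i ∈ run.A r ω, ∀ k, 1 ≤ k →
      |empMean (run.table ω) i r k - μ i| ≤ confRadius C k (bracketLevel n δ r) := by
    intro r hr i hi k hk
    by_contra hcon
    exact hω r hr i ⟨hi, k, hk, not_le.1 hcon⟩
  have h1 := (abs_le.1 (hfine r hr i (run.mem_A_of_pullCount_pos hi) _ hi)).1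
  have h2 := (abs_le.1 (hfine r' hr' _ ho _ hoT)).2
  have h3 : μ b < μ i - 2 * confRadius C (pullCount (run.pulls ω) i r t) (bracketLevel n δ r) := by
    by_contra hcon
    exact hu ⟨_, le_rfl, not_lt.1 hcon⟩
  unfold lcb at hle
  change empMean (run.table ω) i r (pullCount (run.pulls ω) i r t) -
      confRadius C (pullCount (run.pulls ω) i r t) (bracketLevel n δ r) ≤
    empMean (run.table ω) (run.O t ω) r' (pullCount (run.pulls ω) (run.O t ω) r' t) -
      confRadius C (pullCount (run.pulls ω) (run.O t ω) r' t) (bracketLevel n δ r') at hle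
  change empMean (run.table ω) (run.O t ω) r' (pullCount (run.pulls ω) (run.O t ω) r' t) -
      μ (run.O t ω) ≤
      confRadius C (pullCount (run.pulls ω) (run.O t ω) r' t) (bracketLevel n δ r') at h2
  linarith

variable [IsProbabilityMeasure P] [∀ i, IsProbabilityMeasure (ν i)] [NeZero n]

/-- The inclusion probability `|A_r| / n` cancels the `|A_r|` in the level, so the sum over all `n`
arms is `δ / r²`. -/
lemma measure_radiusFails_le (hC : IsAnytimeConstant C) (hν : ∀ i, IsOneSubGaussian (ν i))
    (hδ : 0 < δ) (hδ1 : δ < 1) (run : BracketUCBRun C δ ν P) {μ : Fin n → ℝ}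
    (hμ : ∀ i, μ i = ∫ y, y ∂(ν i)) (i : Fin n) {r : ℕ} (hr : 1 ≤ r) :
    P (run.radiusFails μ i r) ≤ ENNReal.ofReal (δ / (n * (r : ℝ) ^ 2)) := by
  have hm : MeasurableSet[run.sources outcomes] {ω | ∃ k, 1 ≤ k ∧
      confRadius C k (bracketLevel n δ r) < |empMean (run.table ω) i r k - μ i|} := by
    have : {ω | ∃ k, 1 ≤ k ∧
        confRadius C k (bracketLevel n δ r) < |empMean (run.table ω) i r k - μ i|} =
        ⋃ k, ⋃ (_ : 1 ≤ k), (fun ω => |empMean (run.table ω) i r k - μ i|) ⁻¹'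
          Set.Ioi (confRadius C k (bracketLevel n δ r)) := by ext; simp
    rw [this]
    refine MeasurableSet.iUnion fun k => MeasurableSet.iUnion fun _ => ?_
    have h1 : Measurable[run.sources outcomes] fun ω => empMean (run.table ω) i r k :=
      run.measurable_empMean_sources (fun s => inr_mem_outcomes _) k
    have h2 : Measurable fun y : ℝ => |y - μ i| := by fun_prop
    exact (h2.comp h1) measurableSet_Ioi
  have hb : (0 : ℝ) < bracketSize n r := by exact_mod_cast bracketSize_pos r
  have hr0 : (0 : ℝ) < r := by exact_mod_cast hr
  unfold radiusFails
  rw [run.measure_inter_outcomes r _ hm]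
  calc _ ≤ ENNReal.ofReal (bracketSize n r / n) * ENNReal.ofReal (bracketLevel n δ r) := by
        refine mul_le_mul' (run.measure_mem_A_le hr i) ?_
        rw [hμ i]
        exact run.measure_exists_confRadius_lt hC hν i r (bracketLevel_pos hδ hr)
          ((bracketLevel_le hδ hr).trans_lt hδ1)
    _ = _ := by
        rw [← ENNReal.ofReal_mul (by positivity)]
        congr 1
        unfold bracketLevel
        field_simp

/-- The factor `2` comes from comparing `1 / (l + 1)²` with `2 / ((l + 1) (l + 2))`, whose sum
telescopes. -/
lemma measure_wrong_recommendation_le (hC : IsAnytimeConstant C)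
    (hν : ∀ i, IsOneSubGaussian (ν i)) (hδ : 0 < δ) (hδ1 : δ < 1) (run : BracketUCBRun C δ ν P)
    {μ : Fin n → ℝ} (hμ : ∀ i, μ i = ∫ y, y ∂(ν i)) (b : Fin n) :
    P {ω | ∃ s : ℕ, 1 ≤ s ∧ run.certTime μ b ω ≤ (s : WithTop ℕ) ∧ μ (run.O s ω) ≤ μ b} ≤
      ENNReal.ofReal (2 * δ) := by
  have hsub : {ω | ∃ s : ℕ, 1 ≤ s ∧ run.certTime μ b ω ≤ (s : WithTop ℕ) ∧
      μ (run.O s ω) ≤ μ b} ⊆ ⋃ l : ℕ, ⋃ i, run.radiusFails μ i (l + 1) := by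
    rintro ω ⟨s, hs, hτ, hO⟩
    by_contra hcon
    rw [run.certTime_le_iff] at hτ
    refine absurd (run.lt_recommended_of_certified hs hτ fun r hr i hf => hcon ?_) (not_lt.2 hO)
    refine Set.mem_iUnion₂.2 ⟨r - 1, i, ?_⟩
    rwa [Nat.sub_add_cancel hr]
  have hn : (0 : ℝ) < n := by exact_mod_cast Nat.pos_of_ne_zero (NeZero.ne n)
  refine (measure_mono hsub).trans ((measure_iUnion_le _).trans
    ((ENNReal.tsum_le_tsum fun l => ?_).trans (tsum_ofReal_telescoping (by linarith))))
  calc P (⋃ i, run.radiusFails μ i (l + 1))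
      ≤ ∑ i : Fin n, ENNReal.ofReal (δ / (n * ((l + 1 : ℕ) : ℝ) ^ 2)) :=
        (measure_iUnion_fintype_le _ _).trans (Finset.sum_le_sum fun i _ =>
          run.measure_radiusFails_le hC hν hδ hδ1 hμ i (by omega))
    _ = ENNReal.ofReal (δ / ((l : ℝ) + 1) ^ 2) := by
        rw [Finset.sum_const, Finset.card_univ, Fintype.card_fin, nsmul_eq_mul,
          ← ENNReal.ofReal_natCast, ← ENNReal.ofReal_mul hn.le]
        congr 1
        push_cast
        field_simp
    _ ≤ _ := by
        refine ENNReal.ofReal_le_ofReal ?_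
        rw [div_le_div_iff₀ (by positivity) (by positivity)]
        have : (0 : ℝ) ≤ l := by positivity
        nlinarith [mul_pos hδ (show (0 : ℝ) < l + 1 by positivity)]

end BracketUCBRun

/-! ### The complexity of an instance -/

/-- Since the means are sorted, the `ε`-good arms form an initial segment, determined by its
cardinality. -/
lemma lt_numGood_iff {n : ℕ} [NeZero n] {μ : Fin n → ℝ} (hμ : Antitone μ) (ε : ℝ) (i : Fin n) :
    (i : ℕ) < numGood μ ε ↔ μ 0 - ε < μ i := by
  unfold numGood
  constructor
  · intro h
    by_contra hcon
    have hsub : Finset.univ.filter (fun k => μ 0 - ε < μ k) ⊆ Finset.Iio i := by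
      intro k hk
      rw [Finset.mem_Iio]
      by_contra hik
      exact hcon ((Finset.mem_filter.1 hk).2.trans_le (hμ (not_lt.1 hik)))
    have := Finset.card_le_card hsub
    rw [Fin.card_Iio] at this
    omega
  · intro h
    have hsub : Finset.Iic i ⊆ Finset.univ.filter (fun k => μ 0 - ε < μ k) := by
      intro k hk
      exact Finset.mem_filter.2 ⟨Finset.mem_univ _, h.trans_le (hμ (Finset.mem_Iic.1 hk))⟩
    have := Finset.card_le_card hsub
    rw [Fin.card_Iic] at this
    omega

lemma armGap_mem_Ioc {n : ℕ} {μ : Fin n → ℝ} (hμ : Antitone μ)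
    (h01 : ∀ i, μ i ∈ Set.Icc (0 : ℝ) 1) {b j : Fin n} (hbj : μ b < μ j) (i : Fin n) :
    armGap μ b j i ∈ Set.Ioc (0 : ℝ) 1 := by
  have hi := h01 i
  have hj := h01 j
  have hb := h01 b
  rw [Set.mem_Icc] at hi hj hb
  unfold armGap
  split_ifs with h
  · exact ⟨by linarith [le_max_right (μ i) (μ j)], by
      linarith [max_le hi.2 hj.2]⟩
  · exact ⟨by linarith [hμ (not_lt.1 h)], by linarith⟩

/-- The summand of arm `i` in `(j + 1) * Hbest`. -/
def armCost {n : ℕ} (μ : Fin n → ℝ) (δ : ℝ) (b j i : Fin n) : ℝ :=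
  1 / armGap μ b j i ^ 2 *
    if i < b then logOne ((n : ℝ) / (((j : ℝ) + 1) * δ) * logOne (1 / armGap μ b j i ^ 2))
    else logOne (logOne (1 / armGap μ b j i ^ 2) / δ)

lemma sum_armCost {n : ℕ} (μ : Fin n → ℝ) (δ : ℝ) (b j : Fin n) :
    ∑ i, armCost μ δ b j i = ((j : ℝ) + 1) * Hbest μ δ b j := by
  have hj : ((j : ℝ) + 1) ≠ 0 := by positivity
  unfold Hbest
  rw [← mul_assoc, mul_one_div_cancel hj, one_mul,
    ← Finset.sum_filter_add_sum_filter_not Finset.univ (fun i => i < b)]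
  simp only [not_lt]
  congr 1
  · refine Finset.sum_congr rfl fun i hi => ?_
    have h := (Finset.mem_filter.1 hi).2
    simp only [armCost, armGap, if_pos h]
  · refine Finset.sum_congr rfl fun i hi => ?_
    have h := not_lt.2 (Finset.mem_filter.1 hi).2
    simp only [armCost, armGap, if_neg h]

lemma one_le_armCost {n : ℕ} {μ : Fin n → ℝ} {δ : ℝ} {b j i : Fin n}
    (h : armGap μ b j i ∈ Set.Ioc (0 : ℝ) 1) : 1 ≤ armCost μ δ b j i := by
  have h1 : 1 ≤ 1 / armGap μ b j i ^ 2 := by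
    have := h.1
    rw [le_div_iff₀ (by positivity)]
    nlinarith [h.2]
  unfold armCost
  refine one_le_mul_of_one_le_of_one_le h1 ?_
  split_ifs <;> exact one_le_logOne _

/-- Gaps are at most one, so every arm costs at least one. This lets `Hbest` absorb the size of the
first relevant bracket. -/
lemma div_le_Hbest {n : ℕ} {μ : Fin n → ℝ} {δ : ℝ} {b j : Fin n}
    (h : ∀ i, armGap μ b j i ∈ Set.Ioc (0 : ℝ) 1) : (n : ℝ) / ((j : ℝ) + 1) ≤ Hbest μ δ b j := by
  rw [div_le_iff₀ (by positivity), mul_comm, ← sum_armCost]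
  calc (n : ℝ) = ∑ _i : Fin n, (1 : ℝ) := by simp
    _ ≤ _ := Finset.sum_le_sum fun i _ => one_le_armCost (h i)

/-- With `a = n / (j + 1)`: since `|A_r| r²` is at most the cube of `2 ^ r`, and `2 ^ r` is of order
`2 ^ s * a`, the level of the `s`-th later bracket enlarges the logarithm only by a factor linear in
`s`. -/
lemma logOne_level_le {n r s : ℕ} [NeZero n] {δ a x : ℝ} (hδ : 0 < δ) (hδ1 : δ ≤ 1) (hr : 1 ≤ r)
    (ha : 1 ≤ a) (h2 : (2 : ℝ) ^ r ≤ 8 * 2 ^ s * a) :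
    logOne (logOne x / bracketLevel n δ r) ≤ 10 * (1 + s) * logOne (a / δ * logOne x) := by
  set w := a / δ * logOne x with hw
  have hx := one_le_logOne x
  have hd : 1 ≤ 1 / δ := by rw [le_div_iff₀ hδ]; linarith
  have hw1 : 1 ≤ w := by
    rw [hw, div_eq_mul_one_div]
    exact one_le_mul_of_one_le_of_one_le (one_le_mul_of_one_le_of_one_le ha hd) hx
  have hb : (0 : ℝ) < bracketSize n r := by exact_mod_cast bracketSize_pos r
  have hr0 : (0 : ℝ) < r := by exact_mod_cast hr
  have hsize : (bracketSize n r : ℝ) * (r : ℝ) ^ 2 ≤ (2 ^ r) ^ 3 := by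
    have e1 : (bracketSize n r : ℝ) ≤ 2 ^ r := by
      have : bracketSize n r ≤ 2 ^ r := min_le_right _ _
      exact_mod_cast this
    have e2 : (r : ℝ) ≤ 2 ^ r := by exact_mod_cast Nat.lt_two_pow_self.le
    calc _ ≤ (2 : ℝ) ^ r * (2 ^ r) ^ 2 := by gcongr
      _ = _ := by ring
  have hle : logOne x / bracketLevel n δ r ≤ 512 * 8 ^ s * w ^ 3 := by
    have e1 : logOne x / bracketLevel n δ r =
        ((bracketSize n r : ℝ) * (r : ℝ) ^ 2) * (1 / δ * logOne x) := by
      unfold bracketLevel; field_simp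
    have e2 : 1 ≤ 1 / δ * logOne x := one_le_mul_of_one_le_of_one_le hd hx
    rw [e1]
    calc _ ≤ (8 * 2 ^ s * a) ^ 3 * (1 / δ * logOne x) := by
          gcongr
          exact hsize.trans (pow_le_pow_left₀ (by positivity) h2 3)
      _ ≤ (8 * 2 ^ s * a) ^ 3 * (1 / δ * logOne x) ^ 3 := by
          gcongr
          exact le_self_pow₀ e2 (by norm_num)
      _ = 512 * (2 ^ 3) ^ s * w ^ 3 := by rw [hw, ← pow_mul]; ring
      _ = _ := by norm_num
  have hl0 : 0 < logOne x / bracketLevel n δ r := div_pos (by linarith) (bracketLevel_pos hδ hr)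
  have hs0 : (0 : ℝ) ≤ s := by positivity
  have hW := one_le_logOne w
  refine max_le ?_ (by nlinarith)
  have h1 := Real.log_le_log hl0 hle
  rw [Real.log_mul (by positivity) (by positivity), Real.log_mul (by positivity) (by positivity),
    Real.log_pow, Real.log_pow] at h1
  have h2 := Real.log_two_lt_d9
  have h512 : Real.log 512 = 9 * Real.log 2 := by
    rw [show (512 : ℝ) = 2 ^ 9 by norm_num, Real.log_pow]; norm_num
  have h8 : Real.log 8 = 3 * Real.log 2 := by
    rw [show (8 : ℝ) = 2 ^ 3 by norm_num, Real.log_pow]; norm_num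
  have hlw := log_le_logOne w
  rw [h512, h8] at h1
  have : (s : ℝ) * (3 * Real.log 2) ≤ 3 * s := by nlinarith
  push_cast at h1
  nlinarith

lemma armLevel_cost_le {n r s : ℕ} [NeZero n] {μ : Fin n → ℝ} {δ : ℝ} {b j i : Fin n}
    (hδ : 0 < δ) (hδ1 : δ ≤ 1) (hr : 1 ≤ r)
    (h2 : (2 : ℝ) ^ r ≤ 8 * 2 ^ s * (n / ((j : ℝ) + 1))) :
    1 / armGap μ b j i ^ 2 * logOne (logOne (1 / armGap μ b j i ^ 2) / armLevel δ b i r) ≤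
      10 * (1 + s) * armCost μ δ b j i := by
  have ha : 1 ≤ (n : ℝ) / ((j : ℝ) + 1) := by
    rw [le_div_iff₀ (by positivity), one_mul]
    exact_mod_cast j.2
  unfold armLevel armCost
  split_ifs with h
  · rw [mul_left_comm]
    refine mul_le_mul_of_nonneg_left ?_ (by positivity)
    have := logOne_level_le (n := n) (x := 1 / armGap μ b j i ^ 2) hδ hδ1 hr ha h2
    rwa [div_div] at this
  · have hc : 0 ≤ 1 / armGap μ b j i ^ 2 * logOne (logOne (1 / armGap μ b j i ^ 2) / δ) :=
      mul_nonneg (by positivity) (logOne_pos _).le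
    have : (0 : ℝ) ≤ s := by positivity
    nlinarith

/-- There is a first bracket of size of the order of `n / (j + 1)`. -/
lemma exists_first_bracket {n : ℕ} (j : Fin n) :
    ∃ r₀ : ℕ, 1 ≤ r₀ ∧ 4 * n ≤ (j + 1) * 2 ^ r₀ ∧ (j + 1) * 2 ^ r₀ ≤ 8 * n := by
  have hex : ∃ r, 4 * n ≤ ((j : ℕ) + 1) * 2 ^ r :=
    ⟨4 * n, Nat.lt_two_pow_self.le.trans (Nat.le_mul_of_pos_left _ (by omega))⟩
  classical
  have h1 := Nat.find_spec hex
  have h0 : Nat.find hex ≠ 0 := by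
    intro h
    rw [h] at h1
    omega
  obtain ⟨q, hq⟩ := Nat.exists_eq_succ_of_ne_zero h0
  have h2 := Nat.find_min hex (m := q) (by omega)
  refine ⟨Nat.find hex, by omega, h1, ?_⟩
  rw [hq, Nat.succ_eq_add_one, pow_succ]
  push Not at h2
  nlinarith

/-! ### The horizon of a good bracket -/

/-- A good bracket `r` with at most `N` pulls until resolution certifies an arm by this time. -/
def horizon (r : ℕ) (N : ℝ) : ℝ :=
  2 * (2 ^ r * r) + 6 * (N + 1) * logOne (6 * (N + 1))

lemma le_of_le_add_mul_logOne {t A B : ℝ} (ht : 0 < t) (hB : 1 ≤ B)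
    (h : t ≤ A + B * logOne t) : t ≤ 2 * A + 2 * B * logOne (2 * B) := by
  have h1 : logOne t ≤ t / (2 * B) + logOne (2 * B) := by
    have h3 := one_le_logOne (2 * B)
    have h4 : 0 < t / (2 * B) := by positivity
    refine max_le ?_ (by linarith)
    have e : t = t / (2 * B) * (2 * B) := by field_simp
    have h5 : Real.log t = Real.log (t / (2 * B)) + Real.log (2 * B) := by
      rw [← Real.log_mul h4.ne' (by positivity), ← e]
    have := Real.log_le_sub_one_of_pos h4
    linarith [log_le_logOne (2 * B)]
  have h2 := mul_le_mul_of_nonneg_left h1 (show 0 ≤ B by linarith)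
  have h3 : B * (t / (2 * B) + logOne (2 * B)) = t / 2 + B * logOne (2 * B) := by
    field_simp
  linarith

/-- Once open, bracket `r` is visited once per cycle and a cycle has at most `3 log t` rounds, so
`t` is at most `2 ^ r * r + 3 (N + 1) log t`; the logarithm is then absorbed. -/
lemma le_horizon {r t : ℕ} {N : ℝ} (hN : 0 ≤ N) (hr : 1 ≤ r) (ht : 2 ^ r * r ≤ t)
    (h : (bracketRounds r t : ℝ) ≤ N) : (t : ℝ) ≤ horizon r N := by
  have h0 : 0 < 2 ^ r * r := by positivity
  have ht1 : 1 ≤ t := by omega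
  have h1 : (t : ℝ) ≤ (2 : ℝ) ^ r * r + openBrackets t * (bracketRounds r t + 1) := by
    exact_mod_cast le_add_mul_bracketRounds hr (le_openBrackets hr le_rfl) ht
  have h2 := openBrackets_le_logOne ht1
  have h3 : (openBrackets t : ℝ) * (bracketRounds r t + 1) ≤ 3 * logOne t * (N + 1) := by
    have := logOne_pos (t : ℝ)
    gcongr
  have := le_of_le_add_mul_logOne (t := t) (A := (2 : ℝ) ^ r * r) (B := 3 * (N + 1))
    (by exact_mod_cast ht1) (by linarith) (by linarith)
  unfold horizon
  have e : 2 * (3 * (N + 1)) = 6 * (N + 1) := by ring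
  rwa [e] at this

lemma nat_le_logOne_two_pow (r : ℕ) : (r : ℝ) ≤ 2 * logOne (2 ^ r) := by
  have h1 := log_le_logOne ((2 : ℝ) ^ r)
  rw [Real.log_pow] at h1
  have h2 := Real.log_two_gt_d9
  have : (0 : ℝ) ≤ r := by positivity
  nlinarith

lemma logOne_mul_pow_mul_le {a q H : ℝ} (ha : 1 ≤ a) (hq : 1 ≤ q) (hq4 : q ≤ 4) (hH : 1 ≤ H)
    (s : ℕ) : logOne (a * q ^ s * H) ≤ (a + 2) * (1 + s) * logOne H := by
  have hqs : (1 : ℝ) ≤ q ^ s := one_le_pow₀ hq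
  have h1 := log_le_logOne H
  have h2 := one_le_logOne H
  have hs : (0 : ℝ) ≤ s := by positivity
  have h3 : 3 ≤ (a + 2) * (1 + s) := by nlinarith
  refine max_le ?_ (by nlinarith)
  rw [Real.log_mul (by positivity) (by positivity), Real.log_mul (by positivity) (by positivity),
    Real.log_pow]
  have h4 := Real.log_le_sub_one_of_pos (show 0 < a by linarith)
  have h5 : Real.log q ≤ 2 := by
    have e : Real.log 4 = 2 * Real.log 2 := by
      rw [show (4 : ℝ) = 2 ^ 2 by norm_num, Real.log_pow]; norm_num
    have := Real.log_le_log (by linarith) hq4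
    have := Real.log_two_lt_d9
    linarith
  have h6 : (s : ℝ) * Real.log q ≤ s * 2 := mul_le_mul_of_nonneg_left h5 hs
  have h7 : a + 1 + 2 * s ≤ (a + 2) * (1 + s) := by nlinarith
  have h8 : (a + 2 * s) * 1 ≤ (a + 2 * s) * logOne H := by gcongr
  have h9 : (a + 1 + 2 * s) * logOne H ≤ (a + 2) * (1 + s) * logOne H := by gcongr
  nlinarith

/-- The horizons grow at most like `8 ^ s`. -/
lemma horizon_add_one_le {r s : ℕ} {κ H : ℝ} (hκ : 0 ≤ κ) (hH : 1 ≤ H)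
    (h2 : (2 : ℝ) ^ r ≤ 8 * 2 ^ s * H) :
    horizon r (κ * 4 ^ s * H) + 1 ≤
      8 ^ s * ((321 + 6 * (κ + 1) * (6 * (κ + 1) + 2)) * (H * logOne H)) := by
  have hL := one_le_logOne H
  have hs : (0 : ℝ) ≤ s := by positivity
  have hs2 : 1 + (s : ℝ) ≤ 2 ^ s := by
    have : s + 1 ≤ 2 ^ s := Nat.lt_two_pow_self
    have h : ((s + 1 : ℕ) : ℝ) ≤ ((2 ^ s : ℕ) : ℝ) := by exact_mod_cast this
    push_cast at h
    linarith
  have h24 : (2 : ℝ) ^ s * 2 ^ s = 4 ^ s := by rw [← mul_pow]; norm_num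
  have h48 : (4 : ℝ) ^ s * 2 ^ s = 8 ^ s := by rw [← mul_pow]; norm_num
  have h4le : (4 : ℝ) ^ s ≤ 8 ^ s := pow_le_pow_left₀ (by norm_num) (by norm_num) s
  have h8one : (1 : ℝ) ≤ 8 ^ s := one_le_pow₀ (by norm_num)
  have h4one : (1 : ℝ) ≤ 4 ^ s := one_le_pow₀ (by norm_num)
  have hHL : 1 ≤ H * logOne H := one_le_mul_of_one_le_of_one_le hH hL
  -- Both parts of the horizon pay one more factor `2 ^ s` for their logarithm: the opening time
  -- grows like `2 ^ s * 2 ^ s`, the pull part like `4 ^ s * 2 ^ s`.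
  have hr : (r : ℝ) ≤ 20 * 2 ^ s * logOne H := by
    have e1 := nat_le_logOne_two_pow r
    have e2 := logOne_mono (by positivity) h2
    have e3 := logOne_mul_pow_mul_le (a := 8) (q := 2) (by norm_num) (by norm_num) (by norm_num)
      hH s
    have e4 : (8 + 2 : ℝ) * (1 + s) * logOne H ≤ 10 * 2 ^ s * logOne H := by
      norm_num; gcongr
    linarith
  have hA : 2 * ((2 : ℝ) ^ r * r) ≤ 320 * (8 ^ s * (H * logOne H)) := by
    calc 2 * ((2 : ℝ) ^ r * r) ≤ 2 * ((8 * 2 ^ s * H) * (20 * 2 ^ s * logOne H)) := by gcongr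
      _ = 320 * ((2 ^ s * 2 ^ s) * (H * logOne H)) := by ring
      _ ≤ _ := by rw [h24]; gcongr
  have hNle : 6 * (κ * 4 ^ s * H + 1) ≤ 6 * (κ + 1) * 4 ^ s * H := by
    have : 1 ≤ (4 : ℝ) ^ s * H := one_le_mul_of_one_le_of_one_le h4one hH
    nlinarith
  have hB : 6 * (κ * 4 ^ s * H + 1) * logOne (6 * (κ * 4 ^ s * H + 1)) ≤
      6 * (κ + 1) * (6 * (κ + 1) + 2) * (8 ^ s * (H * logOne H)) := by
    have e1 : logOne (6 * (κ * 4 ^ s * H + 1)) ≤ (6 * (κ + 1) + 2) * 2 ^ s * logOne H := by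
      refine (logOne_mono (by positivity) hNle).trans ?_
      refine (logOne_mul_pow_mul_le (by linarith) (by norm_num) (by norm_num) hH s).trans ?_
      gcongr
    calc _ ≤ (6 * (κ + 1) * 4 ^ s * H) * ((6 * (κ + 1) + 2) * 2 ^ s * logOne H) :=
          mul_le_mul hNle e1 (logOne_pos _).le (by positivity)
      _ = 6 * (κ + 1) * (6 * (κ + 1) + 2) * ((4 ^ s * 2 ^ s) * (H * logOne H)) := by ring
      _ = _ := by rw [h48]
  have hone : 1 ≤ (8 : ℝ) ^ s * (H * logOne H) := one_le_mul_of_one_le_of_one_le h8one hHL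
  unfold horizon
  calc _ ≤ 320 * (8 ^ s * (H * logOne H)) + 6 * (κ + 1) * (6 * (κ + 1) + 2) *
        (8 ^ s * (H * logOne H)) + 8 ^ s * (H * logOne H) := by gcongr
    _ = _ := by ring

lemma horizon_nonneg (r : ℕ) {N : ℝ} (hN : 0 ≤ N) : 0 ≤ horizon r N := by
  have := logOne_pos (6 * (N + 1))
  unfold horizon; positivity

namespace BracketUCBRun

variable {n : ℕ} {C δ : ℝ} {ν : Fin n → Measure ℝ} {Ω : Type*} [mΩ : MeasurableSpace Ω]
  {P : Measure Ω}

lemma certTime_le_of_goodBracket (run : BracketUCBRun C δ ν P) {μ : Fin n → ℝ}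
    (hμ : Antitone μ) {b j : Fin n} {ω : Ω} {r : ℕ} {N : ℝ} (hN : 0 ≤ N) (hr : 1 ≤ r)
    (hg : ω ∈ run.goodBracket μ b j r (ENNReal.ofReal N)) :
    ENat.toENNReal (run.certTime μ b ω) ≤ ENNReal.ofReal (horizon r N + 1) := by
  -- The first integer strictly beyond the horizon: being uncertified there contradicts
  -- `le_horizon`.
  set t := ⌊horizon r N⌋₊ + 1 with ht
  have hlt : horizon r N < t := by rw [ht]; push_cast; exact Nat.lt_floor_add_one _
  have h2r : (2 : ℝ) ^ r * r ≤ horizon r N := by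
    have := logOne_pos (6 * (N + 1))
    have h1 : 0 ≤ 6 * (N + 1) * logOne (6 * (N + 1)) := by positivity
    have h3 : (0 : ℝ) ≤ 2 ^ r * r := by positivity
    unfold horizon; linarith
  have htr : 2 ^ r * r ≤ t := by
    have : (2 : ℝ) ^ r * r ≤ t := h2r.trans hlt.le
    exact_mod_cast this
  have hc : Certified C δ μ b (run.pulls ω) t := by
    by_contra hcon
    have h1 := run.bracketRounds_le_of_goodBracket hμ hr (le_openBrackets hr htr) hg hcon
    rw [← ENNReal.ofReal_natCast, ENNReal.ofReal_le_ofReal_iff hN] at h1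
    exact absurd (le_horizon hN hr htr h1) (not_le.2 hlt)
  have hle := (run.certTime_le_iff μ b ω t).2 hc
  calc ENat.toENNReal (run.certTime μ b ω) ≤ ENat.toENNReal ((t : ℕ) : ℕ∞) :=
        ENat.toENNReal_mono hle
    _ = ENNReal.ofReal (t : ℝ) := by rw [ENat.toENNReal_coe, ENNReal.ofReal_natCast]
    _ ≤ _ := by
        refine ENNReal.ofReal_le_ofReal ?_
        rw [ht]; push_cast
        gcongr
        exact Nat.floor_le (horizon_nonneg r hN)

/-- The time of certification is bounded by the horizon of the first good bracket. -/
lemma certTime_le_tsum (run : BracketUCBRun C δ ν P) {μ : Fin n → ℝ}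
    (hμ : Antitone μ) (b j : Fin n) (ω : Ω) {r₀ : ℕ} (hr₀ : 1 ≤ r₀) {N : ℕ → ℝ}
    (hN : ∀ r, 0 ≤ N r) :
    ENat.toENNReal (run.certTime μ b ω) ≤
      ∑' s : ℕ, (⋂ q ∈ Finset.range s,
        (run.goodBracket μ b j (r₀ + q) (ENNReal.ofReal (N (r₀ + q))))ᶜ).indicator
          (fun _ => ENNReal.ofReal (horizon (r₀ + s) (N (r₀ + s)) + 1)) ω := by
  classical
  by_cases hex : ∃ s, ω ∈ run.goodBracket μ b j (r₀ + s) (ENNReal.ofReal (N (r₀ + s)))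
  · refine le_trans ?_ (ENNReal.le_tsum (Nat.find hex))
    rw [Set.indicator_of_mem]
    · exact run.certTime_le_of_goodBracket hμ (hN _) (by omega) (Nat.find_spec hex)
    · exact Set.mem_iInter₂.2 fun q hq => Nat.find_min hex (Finset.mem_range.1 hq)
  -- If no bracket is good, every indicator is one and every term at least one, so the sum is
  -- infinite and the bound holds trivially.
  · push Not at hex
    have htop : ∑' s : ℕ, (⋂ q ∈ Finset.range s,
        (run.goodBracket μ b j (r₀ + q) (ENNReal.ofReal (N (r₀ + q))))ᶜ).indicator
          (fun _ => ENNReal.ofReal (horizon (r₀ + s) (N (r₀ + s)) + 1)) ω = ⊤ := by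
      refine eq_top_iff.2 ?_
      rw [← ENNReal.tsum_const_eq_top_of_ne_zero (α := ℕ) (c := 1) one_ne_zero]
      refine ENNReal.tsum_le_tsum fun s => ?_
      rw [Set.indicator_of_mem (Set.mem_iInter₂.2 fun q _ => hex q), ENNReal.one_le_ofReal]
      linarith [horizon_nonneg (r₀ + s) (hN (r₀ + s))]
    rw [htop]
    exact le_top

/-- The expected time of certification. -/
lemma lintegral_certTime_le [NeZero n] [IsProbabilityMeasure P]
    [∀ i, IsProbabilityMeasure (ν i)] (hC : IsAnytimeConstant C) {K : ℝ} (hK1 : 1 ≤ K)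
    (hK : ∀ x α : ℝ, 1 ≤ x → 0 < α → α ≤ 1 → ∀ k : ℕ, K * (x * logOne (logOne x / α)) ≤ k →
      ∀ d : ℝ, 0 < d → x = 1 / d ^ 2 → confRadius C k α < d / 8)
    (hν : ∀ i, IsOneSubGaussian (ν i)) (hδ : 0 < δ) (hδ1 : δ ≤ 0.025)
    (run : BracketUCBRun C δ ν P) {μ : Fin n → ℝ} (hμ : ∀ i, μ i = ∫ y, y ∂(ν i))
    (h01 : ∀ i, μ i ∈ Set.Icc (0 : ℝ) 1) (hanti : Antitone μ) {b j : Fin n} (hbj : μ b < μ j)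
    {κ : ℝ} (hκ : κ = 8000 * (K + 67)) :
    ∫⁻ ω, ENat.toENNReal (run.certTime μ b ω) ∂P ≤
      ENNReal.ofReal (2 * (321 + 6 * (κ + 1) * (6 * (κ + 1) + 2)) *
        (Hbest μ δ b j * logOne (Hbest μ δ b j))) := by
  have hgap := armGap_mem_Ioc hanti h01 hbj
  set H := Hbest μ δ b j with hH
  have hn : (0 : ℝ) < n := by exact_mod_cast Nat.pos_of_ne_zero (NeZero.ne n)
  have hj0 : (0 : ℝ) < (j : ℝ) + 1 := by positivity
  have hnH : (n : ℝ) / ((j : ℝ) + 1) ≤ H := div_le_Hbest hgap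
  have hH1 : 1 ≤ H := by
    refine le_trans ?_ hnH
    rw [le_div_iff₀ hj0, one_mul]
    exact_mod_cast j.2
  have hκ0 : 0 ≤ κ := by rw [hκ]; linarith
  obtain ⟨r₀, hr₀, hlow, hup⟩ := exists_first_bracket j
  -- The expected pull bound of bracket `r₀ + s` is at most `80 (K + 67) * 2 ^ s * (1 + s) * H`: `2
  -- ^ s` from its size, `1 + s` from its level. Replacing `1 + s` by `2 ^ s` and multiplying by the
  -- `100` of Markov's inequality gives `κ * 4 ^ s * H`.
  set N : ℕ → ℝ := fun r => κ * 4 ^ (r - r₀) * H with hN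
  have hNpos : ∀ r, 0 < N r := fun r => by
    have : 0 < κ := by rw [hκ]; linarith
    simp only [hN]; positivity
  have hpow : ∀ s : ℕ, (2 : ℝ) ^ (r₀ + s) ≤ 8 * 2 ^ s * (n / ((j : ℝ) + 1)) := fun s => by
    have h : ((j : ℝ) + 1) * 2 ^ r₀ ≤ 8 * n := by exact_mod_cast hup
    rw [pow_add, mul_div_assoc', le_div_iff₀ hj0]
    have : (0 : ℝ) < 2 ^ s := by positivity
    nlinarith
  have hgood : ∀ r, r₀ ≤ r →
      P (run.goodBracket μ b j r (ENNReal.ofReal (N r)))ᶜ ≤ ENNReal.ofReal (1 / 16) := by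
    intro r hr
    obtain ⟨s, rfl⟩ := Nat.exists_eq_add_of_le hr
    refine run.measure_goodBracket_compl_le hC hν hδ hδ1 hμ b j (by omega) ?_ (hNpos _) ?_
    · refine hlow.trans (Nat.mul_le_mul_left _ (Nat.pow_le_pow_right (by norm_num) hr))
    have hs0 : (0 : ℝ) ≤ s := by positivity
    have hcost : ∀ i, 0 ≤ armCost μ δ b j i := fun i =>
      zero_le_one.trans (one_le_armCost (hgap i))
    calc ∑ i, ENNReal.ofReal (bracketSize n (r₀ + s) / n) *
          ∫⁻ ω, pullBound C δ μ b j (run.table ω) i (r₀ + s) ∂P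
        ≤ ∑ i, ENNReal.ofReal (8 * 2 ^ s / ((j : ℝ) + 1) *
            ((K + 67) * (10 * (1 + s) * armCost μ δ b j i))) := by
          refine Finset.sum_le_sum fun i _ => ?_
          rw [ENNReal.ofReal_mul (by positivity)]
          refine mul_le_mul' (ENNReal.ofReal_le_ofReal ?_) ?_
          · rw [div_le_iff₀ hn]
            have e : (bracketSize n (r₀ + s) : ℝ) ≤ 2 ^ (r₀ + s) := by
              have : bracketSize n (r₀ + s) ≤ 2 ^ (r₀ + s) := min_le_right _ _
              exact_mod_cast this
            refine (e.trans (hpow s)).trans (le_of_eq ?_)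
            field_simp
          · refine (run.lintegral_pullBound_le hC.nonneg hK1 hK hν hδ (by linarith) hμ b j i
              (by omega) (hgap i).1 (hgap i).2).trans (ENNReal.ofReal_le_ofReal ?_)
            exact mul_le_mul_of_nonneg_left
              (armLevel_cost_le hδ (by linarith) (by omega) (hpow s)) (by linarith)
      _ = ENNReal.ofReal (∑ i, 8 * 2 ^ s / ((j : ℝ) + 1) *
            ((K + 67) * (10 * (1 + s) * armCost μ δ b j i))) := by
          rw [ENNReal.ofReal_sum_of_nonneg]
          intro i _
          have := hcost i
          have : 0 ≤ K + 67 := by linarith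
          positivity
      _ ≤ _ := by
          refine ENNReal.ofReal_le_ofReal ?_
          rw [← Finset.mul_sum, ← Finset.mul_sum, ← Finset.mul_sum, sum_armCost, ← hH]
          have e1 : 8 * 2 ^ s / ((j : ℝ) + 1) *
              ((K + 67) * (10 * (1 + s) * (((j : ℝ) + 1) * H))) =
              80 * (K + 67) * H * (2 ^ s * (1 + s)) := by field_simp; ring
          have e2 : 1 + (s : ℝ) ≤ 2 ^ s := by
            have : s + 1 ≤ 2 ^ s := Nat.lt_two_pow_self
            have h : ((s + 1 : ℕ) : ℝ) ≤ ((2 ^ s : ℕ) : ℝ) := by exact_mod_cast this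
            push_cast at h
            linarith
          have e3 : (2 : ℝ) ^ s * 2 ^ s = 4 ^ s := by rw [← mul_pow]; norm_num
          have e4 : (2 : ℝ) ^ s * (1 + s) ≤ 4 ^ s := by rw [← e3]; gcongr
          have e5 : N (r₀ + s) / 100 = 80 * (K + 67) * H * 4 ^ s := by
            simp only [hN, hκ, Nat.add_sub_cancel_left]; ring
          rw [e1, e5]
          have : 0 ≤ K + 67 := by linarith
          gcongr
  set M := (321 + 6 * (κ + 1) * (6 * (κ + 1) + 2)) * (H * logOne H) with hM
  have hM0 : 0 ≤ M := by
    have := logOne_pos H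
    positivity
  set B : ℕ → Set Ω := fun s => ⋂ q ∈ Finset.range s,
    (run.goodBracket μ b j (r₀ + q) (ENNReal.ofReal (N (r₀ + q))))ᶜ with hB
  have hBm : ∀ s, MeasurableSet (B s) := fun s => Finset.measurableSet_biInter _ fun q _ =>
    (run.sources_le _ _ (run.measurableSet_goodBracket μ b j _ _ (Set.mem_univ _))).compl
  have hBle : ∀ s, P (B s) ≤ ENNReal.ofReal (1 / 16) ^ s := fun s =>
    run.measure_iInter_goodBracket_compl_le μ b j (fun r => ENNReal.ofReal (N r)) r₀ _ hgood s
  calc ∫⁻ ω, ENat.toENNReal (run.certTime μ b ω) ∂P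
      ≤ ∫⁻ ω, ∑' s : ℕ, (B s).indicator
          (fun _ => ENNReal.ofReal (horizon (r₀ + s) (N (r₀ + s)) + 1)) ω ∂P :=
        lintegral_mono fun ω => run.certTime_le_tsum hanti b j ω hr₀ fun r => (hNpos r).le
    _ = ∑' s : ℕ, ENNReal.ofReal (horizon (r₀ + s) (N (r₀ + s)) + 1) * P (B s) := by
        rw [lintegral_tsum fun s => (measurable_const.indicator (hBm s)).aemeasurable]
        refine tsum_congr fun s => ?_
        rw [lintegral_indicator_const (hBm s)]
    -- Growth `8 ^ s` of the horizon against failure probability `16 ^ (-s)`; the geometric sum is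
    -- the factor `2` in the constant.
    _ ≤ ∑' s : ℕ, ENNReal.ofReal M * ENNReal.ofReal (1 / 2) ^ s := by
        refine ENNReal.tsum_le_tsum fun s => ?_
        have hh : horizon (r₀ + s) (N (r₀ + s)) + 1 ≤ 8 ^ s * M := by
          have h2 : (2 : ℝ) ^ (r₀ + s) ≤ 8 * 2 ^ s * H := (hpow s).trans (by gcongr)
          have := horizon_add_one_le hκ0 hH1 h2
          simpa only [hN, Nat.add_sub_cancel_left] using this
        calc _ ≤ ENNReal.ofReal (8 ^ s * M) * ENNReal.ofReal (1 / 16) ^ s :=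
              mul_le_mul' (ENNReal.ofReal_le_ofReal hh) (hBle s)
          _ = _ := by
              rw [← ENNReal.ofReal_pow (by norm_num), ← ENNReal.ofReal_mul (by positivity),
                ← ENNReal.ofReal_pow (by norm_num), ← ENNReal.ofReal_mul hM0]
              congr 1
              rw [mul_comm _ M, mul_assoc, ← mul_pow]
              norm_num
    _ = ENNReal.ofReal (2 * (321 + 6 * (κ + 1) * (6 * (κ + 1) + 2)) * (H * logOne H)) := by
        rw [ENNReal.tsum_mul_left, ENNReal.tsum_geometric, ← ENNReal.ofReal_one,
          ← ENNReal.ofReal_sub _ (by norm_num), ← ENNReal.ofReal_inv_of_pos (by norm_num),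
          ← ENNReal.ofReal_mul hM0]
        congr 1
        rw [hM]; norm_num; ring

end BracketUCBRun

/-- The argument yields `H log H`; the additional term inside the logarithm is nonnegative and only
weakens the bound. -/
lemma Hbest_mul_logOne_le {n : ℕ} {μ : Fin n → ℝ} {δ : ℝ} {b j : Fin n}
    (hH : 0 < Hbest μ δ b j) :
    Hbest μ δ b j * logOne (Hbest μ δ b j) ≤ epsGoodBound μ δ b j := by
  unfold epsGoodBound
  refine mul_le_mul_of_nonneg_left (logOne_mono hH ?_) hH.le
  exact le_add_of_nonneg_right (mul_nonneg (by positivity) (logOne_pos _).le)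

end

/-! ### Assembly: one stopping time for all `j` -/

theorem theorem2 :
    (∃ C : ℝ, IsAnytimeConstant C) ∧
    ∀ C : ℝ, IsAnytimeConstant C →
      ∃ c : ℝ, 0 < c ∧
        ∀ (n : ℕ) [NeZero n] (δ ε : ℝ), 0 < δ → δ ≤ 0.025 → 0 < ε →
        ∀ (ν : Fin n → Measure ℝ) [∀ i, IsProbabilityMeasure (ν i)],
          (∀ i, IsOneSubGaussian (ν i)) →
        ∀ (μ : Fin n → ℝ), (∀ i, μ i = ∫ y, y ∂(ν i)) →
          (∀ i, μ i ∈ Set.Icc (0 : ℝ) 1) → Antitone μ →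
        ∀ (hm : numGood μ ε < n) (Ω : Type*) [MeasurableSpace Ω] (P : Measure Ω)
          [IsProbabilityMeasure P] (run : BracketUCBRun C δ ν P),
        ∃ τ : Ω → WithTop ℕ, IsStoppingTime run.history τ ∧
          (∀ j : Fin n, (j : ℕ) < numGood μ ε →
            ∫⁻ ω, ENat.toENNReal (τ ω) ∂P ≤
              ENNReal.ofReal (c * epsGoodBound μ δ ⟨numGood μ ε, hm⟩ j)) ∧
          P {ω | ∃ s : ℕ, 1 ≤ s ∧ τ ω ≤ (s : WithTop ℕ) ∧ μ (run.O s ω) ≤ μ 0 - ε} ≤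
            ENNReal.ofReal (2 * δ) := by
  refine ⟨⟨5, isAnytimeConstant_five⟩, fun C hC => ?_⟩
  obtain ⟨K, hK1, hK⟩ := exists_confRadius_lt C
  set κ : ℝ := 8000 * (K + 67) with hκ
  have hκ0 : 0 ≤ κ := by rw [hκ]; linarith
  refine ⟨2 * (321 + 6 * (κ + 1) * (6 * (κ + 1) + 2)), by positivity, ?_⟩
  intro n _ δ ε hδ hδ1 hε ν _ hν μ hμ h01 hanti hm Ω _ P _ run
  set b : Fin n := ⟨numGood μ ε, hm⟩ with hb
  have hbad : μ b ≤ μ 0 - ε := by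
    by_contra hcon
    exact absurd ((lt_numGood_iff hanti ε b).2 (not_le.1 hcon)) (lt_irrefl _)
  refine ⟨run.certTime μ b, run.isStoppingTime_certTime μ b, fun j hj => ?_, ?_⟩
  · have hbj : μ b < μ j := hbad.trans_lt ((lt_numGood_iff hanti ε j).1 hj)
    have hH : 0 < Hbest μ δ b j := by
      refine lt_of_lt_of_le ?_ (div_le_Hbest (armGap_mem_Ioc hanti h01 hbj))
      have : (0 : ℝ) < n := by exact_mod_cast Nat.pos_of_ne_zero (NeZero.ne n)
      positivity
    refine (run.lintegral_certTime_le hC hK1 hK hν hδ hδ1 hμ h01 hanti hbj hκ).trans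
      (ENNReal.ofReal_le_ofReal ?_)
    exact mul_le_mul_of_nonneg_left (Hbest_mul_logOne_le hH) (by positivity)
  · refine (measure_mono ?_).trans
      (run.measure_wrong_recommendation_le hC hν hδ (by linarith) hμ b)
    rintro ω ⟨s, hs, hτ, hO⟩
    refine ⟨s, hs, hτ, ?_⟩
    -- No mean lies strictly between `μ b` and the `ε`-good means, so a recommendation that is not
    -- `ε`-good has mean at most `μ b`.
    by_contra hcon
    have hlt : run.O s ω < b := by
      by_contra h
      exact hcon (hanti (not_lt.1 h))
    exact absurd ((lt_numGood_iff hanti ε _).1 hlt) (not_lt.2 hO)
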